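/- A Jacobi matrix is a bounded self-adjoint operator $J=J_{a,b}$ on $\ell^2(\mathbb Z)$ (complex sequences) of the form $(J\varphi)_n=a_{n-1}\varphi_{n-1}+b_n\varphi_n+a_n\varphi_{n+1}$, where $a,b$ are bounded real sequences with $\inf_n a_n>0$. It is $q$-periodic ($q\in\mathbb Z_+$) if $a_{n+q}=a_n$ and $b_{n+q}=b_n$ for all $n$, and limit-periodic if it is an operator-norm limit of periodic Jacobi matrices. For $\eta>0$, a limit-periodic $J$ belongs to $\mathrm{EC}(\eta)$ if there are $q_n$-periodic Jacobi matrices $J_n$ with $q_n\mid q_{n+1}$, $q_n\ne q_{n+1}$ for all $n$, and $\lim_{n\to\infty}e^{\eta q_{n+1}}\|J-J_n\|=0$; and $J\in\mathrm{EC}(\infty)$ if $J\in\mathrm{EC}(\eta)$ for every $\eta>0$. Let $X$ be the position operator $(X\varphi)_n=n\varphi_n$ with domain $D(X)=\{\varphi\in\ell^2(\mathbb Z):\sum_n|n\varphi_n|^2<\infty\}$, and let $X_J(t)=e^{itJ}Xe^{-itJ}$ on its natural domain. For $p>0$ and $\varphi\in\ell^2(\mathbb Z)$ let $|X|^p_\varphi(t)=\sum_{n}(|n|^p+1)\,|\langle\delta_n,e^{-itJ}\varphi\rangle|^2\in[0,\infty]$,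 and $$\beta^+_\varphi(p)=\limsup_{t\to\infty}\frac{\log|X|^p_\varphi(t)}{p\log t},\qquad \beta^-_\varphi(p)=\liminf_{t\to\infty}\frac{\log|X|^p_\varphi(t)}{p\log t}.$$ **Corollary.** If $J\in\mathrm{EC}(\infty)$, then the quantum dynamics generated by $J$ are ballistic in the following sense. There is a bounded self-adjoint operator $Q_J$ on $\ell^2(\mathbb Z)$ such that $$\operatorname*{s-lim}_{t\to\infty}\tfrac1t X_J(t)=Q_J,$$ that is, every $\varphi\in D(X)$ lies in the domain of $X_J(t)$ for all $t\in\mathbb R$, and $t^{-1}X_J(t)\varphi\to Q_J\varphi$ in $\ell^2(\mathbb Z)$ as $t\to\infty$; moreover $\ker(Q_J)\cap\ell^1(\mathbb Z)=\{0\}$. In particular, $\beta^{\pm}_\varphi(p)=1$ for all $p>0$ and all nonzero $\varphi\in\ell^2(\mathbb Z)$ with $\sum_n|n|^p|\varphi_n|<\infty$ for every $p>0$. -/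

import Mathlib

open Filter Topology
open scoped ENNReal

noncomputable section

/-- The Hilbert space of square-summable complex sequences indexed by the integers. -/
abbrev EllTwo : Type := lp (fun _ : ℤ => ℂ) 2

/-- Weighted shifts of square-summable sequences by bounded weights are square-summable. -/
theorem memℓp_weightedShift (w : ℤ → ℝ) (hw : ∃ C : ℝ, ∀ n, |w n| ≤ C) (k : ℤ) (φ : EllTwo) :
    Memℓp (fun n : ℤ => (w n : ℂ) * φ (n + k)) 2 := by
  obtain ⟨C, hC⟩ := hw
  have h1 : Summable fun n : ℤ => ‖φ n‖ ^ (2 : ℝ≥0∞).toReal := (lp.memℓp φ).summable (by norm_num)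
  have h2 : Summable fun n : ℤ => ‖φ (n + k)‖ ^ (2 : ℝ≥0∞).toReal :=
    h1.comp_injective (i := fun n : ℤ => n + k) (add_left_injective k)
  refine memℓp_gen ((h2.mul_left (C ^ 2)).of_nonneg_of_le (fun n => by positivity) fun n => ?_)
  have h3 : |w n| ^ 2 ≤ C ^ 2 := pow_le_pow_left₀ (abs_nonneg _) (hC n) 2
  simp only [ENNReal.toReal_ofNat, Real.rpow_ofNat, norm_mul, Complex.norm_real, Real.norm_eq_abs,
    mul_pow]
  gcongr

/-- The bounded operator `(W φ) n = w n * φ (n + k)` on `ℓ²(ℤ)`, for a bounded real sequence `w`. -/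
def weightedShift (w : ℤ → ℝ) (hw : ∃ C : ℝ, ∀ n, |w n| ≤ C) (k : ℤ) : EllTwo →L[ℂ] EllTwo :=
  LinearMap.mkContinuousOfExistsBound
    { toFun := fun φ => ⟨fun n : ℤ => (w n : ℂ) * φ (n + k), memℓp_weightedShift w hw k φ⟩
      map_add' := fun φ ψ => by
        ext n
        exact mul_add _ _ _
      map_smul' := fun c φ => by
        ext n
        simp [mul_left_comm] }
    (by
      obtain ⟨C, hC⟩ := hw
      have hC0 : 0 ≤ C := (abs_nonneg _).trans (hC 0)
      refine ⟨C, fun φ => lp.norm_le_of_forall_sum_le (by norm_num) (by positivity) fun s => ?_⟩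
      have h4 := lp.sum_rpow_le_norm_rpow (p := 2) (by norm_num) φ
        (s.map (addRightEmbedding k))
      simp only [ENNReal.toReal_ofNat, Real.rpow_ofNat, Finset.sum_map, addRightEmbedding_apply]
        at h4
      simp only [ENNReal.toReal_ofNat, Real.rpow_ofNat, LinearMap.coe_mk, AddHom.coe_mk, norm_mul,
        Complex.norm_real, Real.norm_eq_abs, mul_pow]
      calc ∑ n ∈ s, |w n| ^ 2 * ‖φ (n + k)‖ ^ 2
          ≤ ∑ n ∈ s, C ^ 2 * ‖φ (n + k)‖ ^ 2 := by
            gcongr with n _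
            exact hC n
        _ = C ^ 2 * ∑ n ∈ s, ‖φ (n + k)‖ ^ 2 := by rw [Finset.mul_sum]
        _ ≤ C ^ 2 * ‖φ‖ ^ 2 := by gcongr)

theorem weightedShift_apply (w : ℤ → ℝ) (hw : ∃ C : ℝ, ∀ n, |w n| ≤ C) (k : ℤ) (φ : EllTwo)
    (n : ℤ) : weightedShift w hw k φ n = (w n : ℂ) * φ (n + k) := rfl

/-- The data of a Jacobi matrix: bounded real sequences `a`, `b` with `inf a > 0`. -/
structure JacobiMatrix where
  a : ℤ → ℝ
  b : ℤ → ℝ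
  bounded_a : ∃ C : ℝ, ∀ n, |a n| ≤ C
  bounded_b : ∃ C : ℝ, ∀ n, |b n| ≤ C
  inf_a_pos : ∃ c : ℝ, 0 < c ∧ ∀ n, c ≤ a n

namespace JacobiMatrix

/-- The bounded operator on `ℓ²(ℤ)` given by a Jacobi matrix (see `op_apply`). -/
def op (J : JacobiMatrix) : EllTwo →L[ℂ] EllTwo :=
  weightedShift (fun n => J.a (n - 1)) (J.bounded_a.imp fun _ h n => h (n - 1)) (-1)
    + weightedShift J.b J.bounded_b 0 + weightedShift J.a J.bounded_a 1

theorem op_apply (J : JacobiMatrix) (φ : EllTwo) (n : ℤ) :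
    J.op φ n = (J.a (n - 1) : ℂ) * φ (n - 1) + (J.b n : ℂ) * φ n + (J.a n : ℂ) * φ (n + 1) := by
  simp [op, weightedShift_apply, sub_eq_add_neg]

/-- `J` is `q`-periodic (here `q` is a positive period, not necessarily the least one). -/
def IsPeriodic (J : JacobiMatrix) (q : ℕ) : Prop :=
  0 < q ∧ ∀ n : ℤ, J.a (n + q) = J.a n ∧ J.b (n + q) = J.b n

/-- `J` is a limit, in operator norm, of periodic Jacobi matrices. -/
def IsLimitPeriodic (J : JacobiMatrix) : Prop :=
  ∃ Jn : ℕ → JacobiMatrix, (∀ n, ∃ q, (Jn n).IsPeriodic q) ∧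
    Tendsto (fun n => ‖J.op - (Jn n).op‖) atTop (𝓝 0)

/-- The exponential class `EC(η)`. -/
def EC (η : ℝ) (J : JacobiMatrix) : Prop :=
  J.IsLimitPeriodic ∧
    ∃ (Jn : ℕ → JacobiMatrix) (q : ℕ → ℕ), (∀ n, (Jn n).IsPeriodic (q n)) ∧
      (∀ n, q n ∣ q (n + 1)) ∧ (∀ n, q n ≠ q (n + 1)) ∧
      Tendsto (fun n => Real.exp (η * (q (n + 1) : ℝ)) * ‖J.op - (Jn n).op‖) atTop (𝓝 0)

/-- The class `EC(∞)`: membership in `EC(η)` for every `η > 0`; the approximating sequence may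
depend on `η`. -/
def ECInfty (J : JacobiMatrix) : Prop := ∀ η : ℝ, 0 < η → EC η J

/-- The unitary group `e^{-itJ}` on `ℓ²(ℤ)`. -/
def evolution (J : JacobiMatrix) (t : ℝ) : EllTwo →L[ℂ] EllTwo :=
  NormedSpace.exp ((-(Complex.I * (t : ℂ))) • J.op)

end JacobiMatrix

/-- The position operator `(X φ) n = n φ n` with its maximal domain in `ℓ²(ℤ)`. -/
def positionOp : EllTwo →ₗ.[ℂ] EllTwo where
  domain :=
    { carrier := {φ | Memℓp (fun n : ℤ => (n : ℂ) * φ n) 2}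
      add_mem' := fun {φ ψ} hφ hψ => by
        have h := Memℓp.add hφ hψ
        simpa [Pi.add_def, mul_add] using h
      zero_mem' := by
        have h : Memℓp (0 : ℤ → ℂ) 2 := zero_memℓp
        simpa [Pi.zero_def] using h
      smul_mem' := fun c φ hφ => by
        have h := Memℓp.const_smul hφ c
        simpa [Pi.smul_def, mul_left_comm] using h }
  toFun :=
    { toFun := fun φ => ⟨fun n : ℤ => (n : ℂ) * φ.1 n, φ.2⟩
      map_add' := fun φ ψ => by
        ext n
        exact mul_add _ _ _
      map_smul' := fun c φ => by
        ext n
        simp [mul_left_comm] }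

namespace JacobiMatrix

/-- The Heisenberg evolution `X_J(t) = e^{itJ} X e^{-itJ}` of the position operator, on its natural
domain `{φ | e^{-itJ} φ ∈ D(X)}`. -/
def heisenberg (J : JacobiMatrix) (t : ℝ) : EllTwo →ₗ.[ℂ] EllTwo where
  domain := positionOp.domain.comap (J.evolution t).toLinearMap
  toFun :=
    { toFun := fun φ => J.evolution (-t) (positionOp ⟨J.evolution t φ.1, φ.2⟩)
      map_add' := fun φ ψ => by
        rw [← map_add, ← LinearPMap.map_add]
        congr 2
        exact Subtype.ext (map_add (J.evolution t) φ.1 ψ.1)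
      map_smul' := fun c φ => by
        rw [RingHom.id_apply, ← map_smul, ← LinearPMap.map_smul]
        congr 2
        exact Subtype.ext (map_smul (J.evolution t) c φ.1) }

/-- `t⁻¹ X_J(t) → Q` strongly as `t → ∞`: every `φ ∈ D(X)` lies in the domain of `X_J(t)` for all
`t`, and `t⁻¹ X_J(t) φ → Q φ` in `ℓ²(ℤ)`. -/
def VelocityConverges (J : JacobiMatrix) (Q : EllTwo →L[ℂ] EllTwo) : Prop :=
  ∀ φ ∈ positionOp.domain, ∃ h : ∀ t : ℝ, φ ∈ (J.heisenberg t).domain,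
    Tendsto (fun t : ℝ => ((t⁻¹ : ℝ) : ℂ) • J.heisenberg t ⟨φ, h t⟩) atTop (𝓝 (Q φ))

/-- The moment `∑ₙ (|n|ᵖ + 1) |⟨δₙ, e^{-itJ} φ⟩|²`, as an element of `[0, ∞]`. -/
def moment (J : JacobiMatrix) (φ : EllTwo) (p t : ℝ) : ℝ≥0∞ :=
  ∑' n : ℤ, ENNReal.ofReal ((|(n : ℝ)| ^ p + 1) * ‖J.evolution t φ n‖ ^ 2)

/-- The upper transport exponent `β⁺_φ(p)`, with `log 0 = -∞` and `log ∞ = ∞`. -/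
def betaPlus (J : JacobiMatrix) (φ : EllTwo) (p : ℝ) : EReal :=
  limsup (fun t : ℝ => ENNReal.log (J.moment φ p t) / ((p * Real.log t : ℝ) : EReal)) atTop

/-- The lower transport exponent `β⁻_φ(p)`. -/
def betaMinus (J : JacobiMatrix) (φ : EllTwo) (p : ℝ) : EReal :=
  liminf (fun t : ℝ => ENNReal.log (J.moment φ p t) / ((p * Real.log t : ℝ) : EReal)) atTop

end JacobiMatrix

/-- Membership in the discrete Schwartz space: `∑ₙ |n|ᵖ |φₙ| < ∞` for all `p > 0`. -/
def IsDiscreteSchwartz (φ : EllTwo) : Prop :=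
  ∀ p : ℝ, 0 < p → Summable fun n : ℤ => |(n : ℝ)| ^ p * ‖φ n‖

end

/-! Write `K = [J, X]` for `velocity` (an anti-self-adjoint bounded operator) and `A_t` for its time
average `timeAvg J.op J.velocity t`, the mean over `[0, t]` of `e^{isJ} K e^{-isJ}`. Integrating the
derivative of `X_J(s)` gives `X_J(t) = X + i t A_t` on `D(X)`. So it suffices that `A_t` converges
strongly to some `A` that annihilates no nonzero summable sequence; then `Q = iA`.

Periodic case. If `J` is `q`-periodic, its discriminant `p`, the trace of the transfer matrix over a
period, satisfies `p(J) = S^q + S^{-q}`. The commutator of this identity with `X` is `q (S^q -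
S^{-q})` on the right, and on the left the value at `p` of the derivation sending `J` to `K`. Since
`[J, A_t] = O(1/t)`, averaging over time collapses that derivation to `p'(J) A_t`. Hence `p'(J) A_t`
and `A_t p'(J)` both equal `q (S^q - S^{-q}) + O(1/t)`, with constants at most exponential in `q`.
No Floquet decomposition is needed. Two consequences follow: `A_t - A_T` is small on the range of
`S^q - S^{-q}`, which approximates every basis vector (`norm_timeAvg_sub_single_le`), and `A_t φ`
cannot be small unless `(S^q - S^{-q}) φ` is (`norm_shift_apply_le`).

Limit-periodic case. For times in the window `[b^{7 q_n}, b^{7 q_{n+1}}]` the operator `J` is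
replaced by `J_n`; the super-exponential approximation makes the error negligible even at the far
end. Gluing the windows gives a summable Cauchy rate (`exists_cauchy_rates`). If `A φ = 0`, this
rate and the lower bound force `(S^{q_n} - S^{-q_n}) φ → 0`, that is `φ_j - φ_{j - 2 q_n} → 0`, so
`φ = 0` (`exists_limit`).

Transport exponents. Conjugating `J` by the weight `(1 + |n|/t)^k` perturbs it by `O(1/t)`, so
weighted norms stay bounded up to time `t`; this gives moments of order at most `t^p`. The limit
`‖X_J(t) φ‖ / t → ‖Q φ‖ > 0`, with an interpolation inequality, gives the matching lower bound for
every `p`. -/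

noncomputable section

open Polynomial

/-! ### Unitary groups, Heisenberg flows and their time averages. -/

section Propagator

variable {H : Type*} [NormedAddCommGroup H] [InnerProductSpace ℂ H] [CompleteSpace H]

/-- The one-parameter group `e^{-itA}` generated by a bounded operator. -/
def propagator (A : H →L[ℂ] H) (t : ℝ) : H →L[ℂ] H :=
  NormedSpace.exp ((-(Complex.I * (t : ℂ))) • A)

theorem propagator_eq_exp_smul (A : H →L[ℂ] H) (t : ℝ) :
    propagator A t = NormedSpace.exp (t • (-Complex.I • A)) := by
  rw [propagator, ← Complex.coe_smul, smul_smul]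
  congr 2
  ring

@[simp]
theorem propagator_zero (A : H →L[ℂ] H) : propagator A 0 = 1 := by
  simp [propagator]

theorem Commute.propagator_right {A B : H →L[ℂ] H} (h : Commute B A) (t : ℝ) :
    Commute B (propagator A t) := by
  exact (h.smul_right _).exp_right

theorem propagator_intertwine {A B W : H →L[ℂ] H} (h : A * W = W * B) (t : ℝ) :
    propagator A t * W = W * propagator B t := by
  let _ : NormedAlgebra ℚ (H →L[ℂ] H) := NormedAlgebra.restrictScalars ℚ ℝ _
  have h1 : SemiconjBy W ((-(Complex.I * (t : ℂ))) • B) ((-(Complex.I * (t : ℂ))) • A) := by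
    simp [SemiconjBy, h]
  exact h1.exp_right.eq.symm

theorem propagator_neg_mul_self (A : H →L[ℂ] H) (t : ℝ) :
    propagator A (-t) * propagator A t = 1 := by
  let _ : NormedAlgebra ℚ (H →L[ℂ] H) := NormedAlgebra.restrictScalars ℚ ℝ _
  rw [propagator, propagator, ← NormedSpace.exp_add_of_commute, ← add_smul]
  · simp
  · exact ((Commute.refl A).smul_left _).smul_right _

theorem propagator_mul_neg_self (A : H →L[ℂ] H) (t : ℝ) :
    propagator A t * propagator A (-t) = 1 := by
  simpa using propagator_neg_mul_self A (-t)

theorem hasDerivAt_propagator (A : H →L[ℂ] H) (t : ℝ) :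
    HasDerivAt (propagator A) ((-Complex.I • A) * propagator A t) t := by
  have h := hasDerivAt_exp_smul_const' (𝕂 := ℝ) (-Complex.I • A) t
  rw [← propagator_eq_exp_smul] at h
  exact h.congr_of_eventuallyEq (.of_forall fun s => propagator_eq_exp_smul A s)

theorem hasDerivAt_propagator_neg (A : H →L[ℂ] H) (t : ℝ) :
    HasDerivAt (fun s => propagator A (-s)) (propagator A (-t) * (Complex.I • A)) t := by
  have h := (hasDerivAt_propagator A (-t)).scomp t (hasDerivAt_neg t)
  have hc := ((Commute.refl A).propagator_right (-t)).eq
  refine h.congr_deriv ?_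
  rw [smul_mul_assoc, hc]
  simp

theorem continuous_propagator (A : H →L[ℂ] H) : Continuous (propagator A) :=
  continuous_iff_continuousAt.2 fun t => (hasDerivAt_propagator A t).continuousAt

theorem star_propagator {A : H →L[ℂ] H} (hA : IsSelfAdjoint A) (t : ℝ) :
    star (propagator A t) = propagator A (-t) := by
  rw [propagator, NormedSpace.star_exp, star_smul, hA.star_eq, propagator]
  congr 2
  simp

theorem norm_propagator_apply {A : H →L[ℂ] H} (hA : IsSelfAdjoint A) (t : ℝ) (φ : H) :
    ‖propagator A t φ‖ = ‖φ‖ := by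
  refine ContinuousLinearMap.norm_map_of_mem_unitary ?_ φ
  rw [Unitary.mem_iff, star_propagator hA]
  exact ⟨propagator_neg_mul_self A t, propagator_mul_neg_self A t⟩

theorem norm_propagator_le {A : H →L[ℂ] H} (hA : IsSelfAdjoint A) (t : ℝ) :
    ‖propagator A t‖ ≤ 1 :=
  ContinuousLinearMap.opNorm_le_bound _ zero_le_one fun φ => by
    rw [norm_propagator_apply hA, one_mul]

theorem norm_propagator_mul {A : H →L[ℂ] H} (hA : IsSelfAdjoint A) (t : ℝ) (B : H →L[ℂ] H) :
    ‖propagator A t * B‖ = ‖B‖ := by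
  have h : ∀ s C, ‖propagator A s * C‖ ≤ ‖C‖ := fun s C =>
    (norm_mul_le _ _).trans (mul_le_of_le_one_left (norm_nonneg _) (norm_propagator_le hA s))
  refine le_antisymm (h t B) ?_
  calc ‖B‖ = ‖propagator A (-t) * (propagator A t * B)‖ := by
        rw [← mul_assoc, propagator_neg_mul_self, one_mul]
    _ ≤ _ := h _ _

/-- The Heisenberg evolution `e^{isA} K e^{-isA}` of a bounded observable `K`. -/
def heisenbergFlow (A K : H →L[ℂ] H) (s : ℝ) : H →L[ℂ] H :=
  propagator A (-s) * K * propagator A s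

theorem continuous_heisenbergFlow (A K : H →L[ℂ] H) : Continuous (heisenbergFlow A K) :=
  (((continuous_propagator A).comp continuous_neg).mul continuous_const).mul
    (continuous_propagator A)

theorem norm_heisenbergFlow_le {A : H →L[ℂ] H} (hA : IsSelfAdjoint A) (K : H →L[ℂ] H) (s : ℝ) :
    ‖heisenbergFlow A K s‖ ≤ ‖K‖ := by
  refine (norm_mul_le _ _).trans ?_
  rw [norm_propagator_mul hA]
  exact mul_le_of_le_one_right (norm_nonneg _) (norm_propagator_le hA s)

theorem hasDerivAt_heisenbergFlow (A K : H →L[ℂ] H) (s : ℝ) :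
    HasDerivAt (heisenbergFlow A K) (Complex.I • heisenbergFlow A (A * K - K * A) s) s := by
  have h := ((hasDerivAt_propagator_neg A s).mul_const K).mul (hasDerivAt_propagator A s)
  refine h.congr_deriv ?_
  simp only [heisenbergFlow, mul_sub, sub_mul, smul_sub, neg_smul, mul_neg, neg_mul,
    mul_smul_comm, smul_mul_assoc, mul_assoc, ← sub_eq_add_neg]

/-- The time average over `[0, t]` of the Heisenberg evolution of `K`. -/
def timeAvg (A K : H →L[ℂ] H) (t : ℝ) : H →L[ℂ] H :=
  t⁻¹ • ∫ s in (0 : ℝ)..t, heisenbergFlow A K s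

theorem norm_timeAvg_le {A : H →L[ℂ] H} (hA : IsSelfAdjoint A) (K : H →L[ℂ] H) {t : ℝ}
    (ht : 0 < t) : ‖timeAvg A K t‖ ≤ ‖K‖ := by
  have h := intervalIntegral.norm_integral_le_of_norm_le_const (a := 0) (b := t)
    (f := heisenbergFlow A K) (C := ‖K‖) fun s _ => norm_heisenbergFlow_le hA K s
  rw [timeAvg, norm_smul, norm_inv, Real.norm_of_nonneg ht.le, inv_mul_le_iff₀ ht]
  rwa [sub_zero, abs_of_pos ht, mul_comm] at h

theorem timeAvg_add (A K L : H →L[ℂ] H) (t : ℝ) :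
    timeAvg A (K + L) t = timeAvg A K t + timeAvg A L t := by
  rw [timeAvg, timeAvg, timeAvg, ← smul_add, ← intervalIntegral.integral_add
    ((continuous_heisenbergFlow A K).intervalIntegrable _ _)
    ((continuous_heisenbergFlow A L).intervalIntegrable _ _)]
  simp only [heisenbergFlow, mul_add, add_mul]

theorem timeAvg_mul_left {A B : H →L[ℂ] H} (h : Commute B A) (K : H →L[ℂ] H) (t : ℝ) :
    timeAvg A (B * K) t = B * timeAvg A K t := by
  rw [timeAvg, timeAvg, mul_smul_comm]
  have h1 := (ContinuousLinearMap.mul ℝ (H →L[ℂ] H) B).intervalIntegral_comp_comm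
    ((continuous_heisenbergFlow A K).intervalIntegrable (μ := MeasureTheory.volume) 0 t)
  rw [ContinuousLinearMap.mul_apply'] at h1
  rw [← h1]
  simp only [heisenbergFlow, ContinuousLinearMap.mul_apply', ← mul_assoc,
    (h.propagator_right _).eq]

theorem timeAvg_mul_right {A B : H →L[ℂ] H} (h : Commute B A) (K : H →L[ℂ] H) (t : ℝ) :
    timeAvg A (K * B) t = timeAvg A K t * B := by
  rw [timeAvg, timeAvg, smul_mul_assoc]
  have h1 := ((ContinuousLinearMap.mul ℝ (H →L[ℂ] H)).flip B).intervalIntegral_comp_comm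
    ((continuous_heisenbergFlow A K).intervalIntegrable (μ := MeasureTheory.volume) 0 t)
  rw [ContinuousLinearMap.flip_apply, ContinuousLinearMap.mul_apply'] at h1
  rw [← h1]
  simp only [heisenbergFlow, ContinuousLinearMap.flip_apply, ContinuousLinearMap.mul_apply',
    mul_assoc, (h.propagator_right _).eq]

theorem timeAvg_smul (A K : H →L[ℂ] H) (c : ℂ) (t : ℝ) :
    timeAvg A (c • K) t = c • timeAvg A K t := by
  have h := timeAvg_mul_left (A := A) (B := c • 1) ((Commute.one_left A).smul_left c) K t
  simpa using h

theorem timeAvg_of_commute {A K : H →L[ℂ] H} (h : Commute K A) {t : ℝ} (ht : t ≠ 0) :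
    timeAvg A K t = K := by
  have h1 : heisenbergFlow A K = fun _ => K := by
    funext s
    rw [heisenbergFlow, mul_assoc, (h.propagator_right s).eq, ← mul_assoc,
      propagator_neg_mul_self, one_mul]
  simp [timeAvg, h1, smul_smul, ht]

/-- The flow of `[A, K]` is, up to the factor `i`, the `s`-derivative of the flow of `K`, so its
integral telescopes to two boundary terms. This makes time averages almost commute with the
generator. -/
theorem norm_commutator_timeAvg_le {A : H →L[ℂ] H} (hA : IsSelfAdjoint A) (K : H →L[ℂ] H) {t : ℝ}
    (ht : 0 < t) : ‖A * timeAvg A K t - timeAvg A K t * A‖ ≤ 2 * ‖K‖ / t := by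
  have h1 : A * timeAvg A K t - timeAvg A K t * A = timeAvg A (A * K - K * A) t := by
    rw [sub_eq_add_neg, sub_eq_add_neg, timeAvg_add, timeAvg_mul_left (Commute.refl A),
      ← neg_one_smul ℂ (K * A), timeAvg_smul, timeAvg_mul_right (Commute.refl A), neg_one_smul]
  have h2 : Complex.I • ∫ s in (0 : ℝ)..t, heisenbergFlow A (A * K - K * A) s
      = heisenbergFlow A K t - heisenbergFlow A K 0 := by
    rw [← intervalIntegral.integral_smul]
    exact intervalIntegral.integral_eq_sub_of_hasDerivAt
      (fun s _ => hasDerivAt_heisenbergFlow A K s)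
      (Continuous.intervalIntegrable ((continuous_heisenbergFlow A _).const_smul Complex.I) _ _)
  have h3 : ‖∫ s in (0 : ℝ)..t, heisenbergFlow A (A * K - K * A) s‖ ≤ 2 * ‖K‖ := by
    have h4 := congrArg norm h2
    rw [norm_smul, Complex.norm_I, one_mul] at h4
    rw [h4, two_mul]
    exact (norm_sub_le _ _).trans
      (add_le_add (norm_heisenbergFlow_le hA K t) (norm_heisenbergFlow_le hA K 0))
  rw [h1, timeAvg, norm_smul, norm_inv, Real.norm_of_nonneg ht.le, inv_mul_eq_div]
  gcongr

/-- Duhamel's argument: `e^{isA} e^{-isB}` has derivative of norm at most `‖A - B‖`. -/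
theorem norm_propagator_sub_le {A B : H →L[ℂ] H} (hA : IsSelfAdjoint A) (hB : IsSelfAdjoint B)
    {t : ℝ} (ht : 0 ≤ t) : ‖propagator A t - propagator B t‖ ≤ t * ‖A - B‖ := by
  set f : ℝ → H →L[ℂ] H := fun s => propagator A (-s) * propagator B s with hf
  have h1 : ∀ s, HasDerivAt f
      (propagator A (-s) * ((Complex.I • (A - B)) * propagator B s)) s := fun s => by
    refine ((hasDerivAt_propagator_neg A s).mul (hasDerivAt_propagator B s)).congr_deriv ?_
    simp only [mul_sub, sub_mul, smul_sub, neg_smul, mul_neg, neg_mul, mul_smul_comm,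
      smul_mul_assoc, mul_assoc, ← sub_eq_add_neg]
  have h2 : ∀ s, ‖propagator A (-s) * ((Complex.I • (A - B)) * propagator B s)‖ ≤ ‖A - B‖ := by
    intro s
    rw [norm_propagator_mul hA, smul_mul_assoc, norm_smul, Complex.norm_I, one_mul]
    exact (norm_mul_le _ _).trans
      (mul_le_of_le_one_right (norm_nonneg _) (norm_propagator_le hB s))
  have h3 := norm_image_sub_le_of_norm_deriv_le_segment' (f := f) (a := 0) (b := t)
    (fun s _ => (h1 s).hasDerivWithinAt) (fun s _ => h2 s) t (Set.right_mem_Icc.2 ht)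
  have h4 : propagator A t - propagator B t = -(propagator A t * (f t - f 0)) := by
    simp [hf, mul_sub, ← mul_assoc, propagator_mul_neg_self]
  rw [h4, norm_neg, norm_propagator_mul hA, mul_comm]
  simpa using h3

theorem norm_timeAvg_sub_le {A B : H →L[ℂ] H} (hA : IsSelfAdjoint A) (hB : IsSelfAdjoint B)
    (K L : H →L[ℂ] H) {t : ℝ} (ht : 0 < t) :
    ‖timeAvg A K t - timeAvg B L t‖ ≤ 2 * t * ‖A - B‖ * ‖K‖ + ‖K - L‖ := by
  have h1 : ∀ s ∈ Set.uIoc 0 t, ‖heisenbergFlow A K s - heisenbergFlow B L s‖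
      ≤ 2 * t * ‖A - B‖ * ‖K‖ + ‖K - L‖ := by
    intro s hs
    rw [Set.uIoc_of_le ht.le] at hs
    have h2 : ‖propagator A s - propagator B s‖ ≤ t * ‖A - B‖ :=
      (norm_propagator_sub_le hA hB hs.1.le).trans (by gcongr; exact hs.2)
    have h3 : ‖propagator A (-s) - propagator B (-s)‖ ≤ t * ‖A - B‖ := by
      rw [← star_propagator hA, ← star_propagator hB, ← star_sub, norm_star]
      exact h2
    have h4 : heisenbergFlow A K s - heisenbergFlow B L s
        = (propagator A (-s) - propagator B (-s)) * K * propagator A s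
          + (propagator B (-s) * (K * (propagator A s - propagator B s))
          + propagator B (-s) * ((K - L) * propagator B s)) := by
      simp only [heisenbergFlow]
      noncomm_ring
    rw [h4]
    refine (norm_add_le _ _).trans ((add_le_add_right (norm_add_le _ _) _).trans ?_)
    rw [norm_propagator_mul hB, norm_propagator_mul hB]
    have h5 : ‖(propagator A (-s) - propagator B (-s)) * K * propagator A s‖
        ≤ t * ‖A - B‖ * ‖K‖ * 1 :=
      norm_mul_le_of_le (norm_mul_le_of_le h3 le_rfl) (norm_propagator_le hA s)
    have h6 : ‖K * (propagator A s - propagator B s)‖ ≤ ‖K‖ * (t * ‖A - B‖) :=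
      norm_mul_le_of_le le_rfl h2
    have h7 : ‖(K - L) * propagator B s‖ ≤ ‖K - L‖ * 1 :=
      norm_mul_le_of_le le_rfl (norm_propagator_le hB s)
    linarith
  have h := intervalIntegral.norm_integral_le_of_norm_le_const h1
  rw [timeAvg, timeAvg, ← smul_sub, ← intervalIntegral.integral_sub
    ((continuous_heisenbergFlow A K).intervalIntegrable _ _)
    ((continuous_heisenbergFlow B L).intervalIntegrable _ _), norm_smul, norm_inv,
    Real.norm_of_nonneg ht.le, inv_mul_le_iff₀ ht]
  rwa [sub_zero, abs_of_pos ht, mul_comm] at h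

/-- `A + E` need not be self-adjoint. In the interaction picture the unitary part drops out and only
`E` drives growth, so Gronwall applies with rate `‖E‖`. -/
theorem norm_propagator_add_le {A : H →L[ℂ] H} (hA : IsSelfAdjoint A) (E : H →L[ℂ] H) {t : ℝ}
    (ht : 0 ≤ t) : ‖propagator (A + E) t‖ ≤ Real.exp (t * ‖E‖) := by
  set f : ℝ → H →L[ℂ] H := fun s => propagator A (-s) * propagator (A + E) s with hf
  have h0 : ∀ s, ‖f s‖ = ‖propagator (A + E) s‖ := fun s => norm_propagator_mul hA _ _
  have h1 : ∀ s, HasDerivAt f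
      (propagator A (-s) * ((-Complex.I • E) * propagator (A + E) s)) s := fun s => by
    refine ((hasDerivAt_propagator_neg A s).mul (hasDerivAt_propagator (A + E) s)).congr_deriv ?_
    simp [mul_assoc, mul_add, add_mul, smul_add]
  have h2 : ∀ s, ‖propagator A (-s) * ((-Complex.I • E) * propagator (A + E) s)‖
      ≤ ‖E‖ * ‖f s‖ + 0 := by
    intro s
    rw [norm_propagator_mul hA, smul_mul_assoc, norm_smul, norm_neg, Complex.norm_I, one_mul, h0,
      add_zero]
    exact norm_mul_le _ _
  have h3 := norm_le_gronwallBound_of_norm_deriv_right_le (f := f) (a := 0) (b := t) (δ := 1)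
    (fun s _ => (h1 s).continuousAt.continuousWithinAt) (fun s _ => (h1 s).hasDerivWithinAt)
    (by rw [h0, propagator_zero]; exact ContinuousLinearMap.norm_id_le (𝕜 := ℂ) (E := H))
    (fun s _ => h2 s) t (Set.right_mem_Icc.2 ht)
  rwa [gronwallBound_ε0, one_mul, sub_zero, h0, mul_comm] at h3

theorem star_timeAvg {A K : H →L[ℂ] H} (hA : IsSelfAdjoint A) (t : ℝ) :
    star (timeAvg A K t) = timeAvg A (star K) t := by
  have h : ∀ s, star (heisenbergFlow A K s) = heisenbergFlow A (star K) s := fun s => by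
    simp [heisenbergFlow, star_propagator hA, mul_assoc]
  have h2 := (starL' ℝ (A := H →L[ℂ] H)).toContinuousLinearMap.intervalIntegral_comp_comm
    ((continuous_heisenbergFlow A K).intervalIntegrable (μ := MeasureTheory.volume) 0 t)
  simp only [ContinuousLinearEquiv.coe_coe, starL'_apply, h] at h2
  rw [timeAvg, star_smul, star_trivial, ← h2, timeAvg]

end Propagator

/-! ### Basis expansions and weighted shifts on the sequence space. -/

theorem EllTwo.hasSum_single (φ : EllTwo) :
    HasSum (fun n : ℤ => φ n • (lp.single 2 n (1 : ℂ) : EllTwo)) φ := by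
  have h := lp.hasSum_single (p := 2) (by norm_num) φ
  refine (funext fun n => ?_ : (fun n : ℤ => φ n • (lp.single 2 n (1 : ℂ) : EllTwo))
    = fun n => lp.single 2 n (φ n)) ▸ h
  rw [← lp.single_smul, smul_eq_mul, mul_one]

theorem EllTwo.add_apply (φ ψ : EllTwo) (n : ℤ) : (φ + ψ) n = φ n + ψ n := rfl

theorem EllTwo.sub_apply (φ ψ : EllTwo) (n : ℤ) : (φ - ψ) n = φ n - ψ n := rfl

theorem EllTwo.smul_apply (c : ℂ) (φ : EllTwo) (n : ℤ) : (c • φ) n = c * φ n := rfl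

theorem EllTwo.clm_ext {B C : EllTwo →L[ℂ] EllTwo}
    (h : ∀ n : ℤ, B (lp.single 2 n (1 : ℂ)) = C (lp.single 2 n (1 : ℂ))) : B = C := by
  ext1 φ
  have h1 := (EllTwo.hasSum_single φ).mapL B
  have h2 := (EllTwo.hasSum_single φ).mapL C
  simp only [map_smul, h] at h1 h2
  exact h1.unique h2

theorem EllTwo.norm_sq_eq_tsum (φ : EllTwo) : ‖φ‖ ^ 2 = ∑' n : ℤ, ‖φ n‖ ^ 2 := by
  have h := lp.norm_rpow_eq_tsum (p := 2) (by norm_num) φ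
  simpa using h

theorem EllTwo.summable_norm_sq (φ : EllTwo) : Summable fun n : ℤ => ‖φ n‖ ^ 2 := by
  have h := (lp.memℓp φ).summable (by norm_num)
  simpa using h

/-- An operator that is small on the standard basis is small on summable sequences. -/
theorem EllTwo.norm_apply_le_of_single {B : EllTwo →L[ℂ] EllTwo} {ε : ℝ} 
    (h : ∀ n : ℤ, ‖B (lp.single 2 n (1 : ℂ))‖ ≤ ε) {φ : EllTwo}
    (hφ : Summable fun n : ℤ => ‖φ n‖) : ‖B φ‖ ≤ ε * ∑' n : ℤ, ‖φ n‖ := by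
  have h1 := (EllTwo.hasSum_single φ).mapL B
  have h2 : ∀ n : ℤ, ‖B (φ n • (lp.single 2 n (1 : ℂ) : EllTwo))‖ ≤ ε * ‖φ n‖ := fun n => by
    rw [map_smul, norm_smul, mul_comm]
    gcongr
    exact h n
  rw [← h1.tsum_eq, ← tsum_mul_left]
  exact tsum_of_norm_bounded (hφ.mul_left ε).hasSum h2

theorem norm_weightedShift_le {w : ℤ → ℝ} (hw : ∃ C : ℝ, ∀ n, |w n| ≤ C) (k : ℤ) {C : ℝ}
    (hC : ∀ n, |w n| ≤ C) : ‖weightedShift w hw k‖ ≤ C := by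
  have hC0 : 0 ≤ C := (abs_nonneg _).trans (hC 0)
  refine ContinuousLinearMap.opNorm_le_bound _ hC0 fun φ => ?_
  refine lp.norm_le_of_forall_sum_le (by norm_num) (by positivity) fun s => ?_
  have h4 := lp.sum_rpow_le_norm_rpow (p := 2) (by norm_num) φ (s.map (addRightEmbedding k))
  simp only [ENNReal.toReal_ofNat, Real.rpow_ofNat, Finset.sum_map, addRightEmbedding_apply] at h4
  simp only [ENNReal.toReal_ofNat, Real.rpow_ofNat, weightedShift_apply, norm_mul,
    Complex.norm_real, Real.norm_eq_abs, mul_pow]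
  calc ∑ n ∈ s, |w n| ^ 2 * ‖φ (n + k)‖ ^ 2
      ≤ ∑ n ∈ s, C ^ 2 * ‖φ (n + k)‖ ^ 2 := by
        gcongr with n _
        exact hC n
    _ = C ^ 2 * ∑ n ∈ s, ‖φ (n + k)‖ ^ 2 := by rw [Finset.mul_sum]
    _ ≤ C ^ 2 * ‖φ‖ ^ 2 := by gcongr

theorem star_weightedShift {w : ℤ → ℝ} (hw : ∃ C : ℝ, ∀ n, |w n| ≤ C) (k : ℤ) :
    star (weightedShift w hw k)
      = weightedShift (fun n => w (n - k)) (hw.imp fun _ h n => h (n - k)) (-k) := by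
  rw [ContinuousLinearMap.star_eq_adjoint, eq_comm, ContinuousLinearMap.eq_adjoint_iff]
  intro φ ψ
  rw [lp.inner_eq_tsum, lp.inner_eq_tsum, ← (Equiv.addRight k).tsum_eq]
  refine tsum_congr fun n => ?_
  simp [weightedShift_apply]
  ring

theorem weightedShift_single {w : ℤ → ℝ} (hw : ∃ C : ℝ, ∀ n, |w n| ≤ C) (k m : ℤ) :
    weightedShift w hw k (lp.single 2 m (1 : ℂ))
      = (w (m - k) : ℂ) • (lp.single 2 (m - k) (1 : ℂ) : EllTwo) := by
  ext n
  rw [weightedShift_apply, lp.coeFn_smul, Pi.smul_apply, lp.single_apply, lp.single_apply]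
  by_cases h : n = m - k
  · subst h
    simp
  · rw [Pi.single_eq_of_ne h, Pi.single_eq_of_ne (by omega)]
    simp

/-- The shift `φ ↦ φ (· + k)` on `ℓ²(ℤ)`. -/
def shiftOp (k : ℤ) : EllTwo →L[ℂ] EllTwo :=
  weightedShift (fun _ => 1) ⟨1, fun _ => by simp⟩ k

@[simp]
theorem shiftOp_apply (k : ℤ) (φ : EllTwo) (n : ℤ) : shiftOp k φ n = φ (n + k) := by
  simp [shiftOp, weightedShift_apply]

theorem shiftOp_single (k m : ℤ) : shiftOp k (lp.single 2 m (1 : ℂ)) = lp.single 2 (m - k) 1 := by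
  simp [shiftOp, weightedShift_single]

/-! ### Jacobi operators and their velocity operators. -/

namespace JacobiMatrix

theorem isSelfAdjoint_op (J : JacobiMatrix) : IsSelfAdjoint J.op := by
  rw [IsSelfAdjoint, op, star_add, star_add, star_weightedShift, star_weightedShift,
    star_weightedShift]
  ext φ n
  simp [weightedShift_apply]
  ring

/-- The commutator `[J, X]` of a Jacobi matrix with the position operator. -/
def velocity (J : JacobiMatrix) : EllTwo →L[ℂ] EllTwo :=
  weightedShift J.a J.bounded_a 1
    - weightedShift (fun n => J.a (n - 1)) (J.bounded_a.imp fun _ h n => h (n - 1)) (-1)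

theorem velocity_apply (J : JacobiMatrix) (φ : EllTwo) (n : ℤ) :
    J.velocity φ n = (J.a n : ℂ) * φ (n + 1) - (J.a (n - 1) : ℂ) * φ (n - 1) := by
  simp [velocity, weightedShift_apply, sub_eq_add_neg]

theorem star_velocity (J : JacobiMatrix) : star J.velocity = -J.velocity := by
  rw [velocity, star_sub, star_weightedShift, star_weightedShift]
  ext φ n
  simp [weightedShift_apply]

/-- The difference of coefficients is a matrix entry of the difference of operators, read off at a
basis vector. -/
theorem abs_a_sub_le (J K : JacobiMatrix) (n : ℤ) : |J.a n - K.a n| ≤ ‖J.op - K.op‖ := by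
  have h1 := lp.norm_apply_le_norm (p := 2) (by norm_num)
    ((J.op - K.op) (lp.single 2 (n + 1) (1 : ℂ))) n
  have h2 := (J.op - K.op).le_opNorm (lp.single 2 (n + 1) (1 : ℂ))
  rw [lp.norm_single (by norm_num), norm_one, mul_one] at h2
  refine le_trans (le_of_eq ?_) (h1.trans h2)
  have h3 : Pi.single (M := fun _ : ℤ => ℂ) (n + 1) (1 : ℂ) (n - 1) = 0 :=
    Pi.single_eq_of_ne (by omega) _
  simp [op_apply, h3, ← Complex.ofReal_sub]

theorem abs_a_le (J : JacobiMatrix) (n : ℤ) : |J.a n| ≤ ‖J.op‖ := by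
  have h1 := lp.norm_apply_le_norm (p := 2) (by norm_num)
    (J.op (lp.single 2 (n + 1) (1 : ℂ))) n
  have h2 := J.op.le_opNorm (lp.single 2 (n + 1) (1 : ℂ))
  rw [lp.norm_single (by norm_num), norm_one, mul_one] at h2
  refine le_trans (le_of_eq ?_) (h1.trans h2)
  have h3 : Pi.single (M := fun _ : ℤ => ℂ) (n + 1) (1 : ℂ) (n - 1) = 0 :=
    Pi.single_eq_of_ne (by omega) _
  simp [op_apply, h3]

theorem abs_b_le (J : JacobiMatrix) (n : ℤ) : |J.b n| ≤ ‖J.op‖ := by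
  have h1 := lp.norm_apply_le_norm (p := 2) (by norm_num)
    (J.op (lp.single 2 n (1 : ℂ))) n
  have h2 := J.op.le_opNorm (lp.single 2 n (1 : ℂ))
  rw [lp.norm_single (by norm_num), norm_one, mul_one] at h2
  refine le_trans (le_of_eq ?_) (h1.trans h2)
  simp [op_apply]

theorem norm_velocity_sub_le (J K : JacobiMatrix) :
    ‖J.velocity - K.velocity‖ ≤ 2 * ‖J.op - K.op‖ := by
  have hw : ∃ C : ℝ, ∀ n, |J.a n - K.a n| ≤ C := ⟨_, J.abs_a_sub_le K⟩
  have h : J.velocity - K.velocity = weightedShift (fun n => J.a n - K.a n) hw 1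
      - weightedShift (fun n => J.a (n - 1) - K.a (n - 1)) (hw.imp fun _ h n => h (n - 1)) (-1) := by
    ext φ n
    simp [velocity, weightedShift_apply]
    ring
  rw [h, two_mul]
  exact (norm_sub_le _ _).trans (add_le_add (norm_weightedShift_le _ _ (J.abs_a_sub_le K))
    (norm_weightedShift_le _ _ fun n => J.abs_a_sub_le K (n - 1)))

theorem norm_velocity_le (J : JacobiMatrix) : ‖J.velocity‖ ≤ 2 * ‖J.op‖ := by
  rw [velocity, two_mul]
  exact (norm_sub_le _ _).trans (add_le_add (norm_weightedShift_le _ _ J.abs_a_le)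
    (norm_weightedShift_le _ _ fun n => J.abs_a_le (n - 1)))

end JacobiMatrix

/-! ### Bounded commutators with the unbounded position operator. -/

/-- `C` is the commutator `[B, X]` of `B` with the position operator. -/
def HasPositionCommutator (B C : EllTwo →L[ℂ] EllTwo) : Prop :=
  ∀ φ ξ : EllTwo, (∀ n : ℤ, ξ n = n * φ n) → ∀ n : ℤ, (n : ℂ) * B φ n = B ξ n - C φ n

namespace HasPositionCommutator

variable {B B' C C' : EllTwo →L[ℂ] EllTwo}

theorem unique (h : HasPositionCommutator B C) (h' : HasPositionCommutator B C') : C = C' := by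
  refine EllTwo.clm_ext fun m => ?_
  have h0 : ∀ n : ℤ, ((m : ℂ) • (lp.single 2 m (1 : ℂ) : EllTwo)) n
      = n * (lp.single 2 m (1 : ℂ) : EllTwo) n := fun n => by
    rw [lp.coeFn_smul, Pi.smul_apply, lp.single_apply]
    by_cases hn : n = m
    · simp [hn]
    · rw [Pi.single_eq_of_ne hn]; simp
  ext n
  exact sub_right_injective ((h _ _ h0 n).symm.trans (h' _ _ h0 n))

theorem one : HasPositionCommutator 1 0 := fun φ ξ h n => by simp [h]

theorem zero : HasPositionCommutator 0 0 := fun φ ξ h n => by simp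

theorem add (h : HasPositionCommutator B C) (h' : HasPositionCommutator B' C') :
    HasPositionCommutator (B + B') (C + C') := fun φ ξ hξ n => by
  simp only [_root_.add_apply, EllTwo.add_apply, mul_add, h φ ξ hξ n, h' φ ξ hξ n]
  ring

theorem smul (h : HasPositionCommutator B C) (c : ℂ) :
    HasPositionCommutator (c • B) (c • C) := fun φ ξ hξ n => by
  simp only [_root_.smul_apply, EllTwo.smul_apply, mul_left_comm, h φ ξ hξ n]
  ring

/-- Leibniz rule. The vector `B' ξ - C' φ` represents `X B' φ`, so `B' φ` is again in the domain of
`X` and the outer commutator can be used. -/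
theorem mul (h : HasPositionCommutator B C) (h' : HasPositionCommutator B' C') :
    HasPositionCommutator (B * B') (B * C' + C * B') := fun φ ξ hξ n => by
  have h1 := h (B' φ) (B' ξ - C' φ) (fun n => (h' φ ξ hξ n).symm) n
  rw [map_sub, EllTwo.sub_apply] at h1
  change (n : ℂ) * B (B' φ) n = B (B' ξ) n - (B (C' φ) n + C (B' φ) n)
  rw [h1]
  ring

end HasPositionCommutator

theorem hasPositionCommutator_shiftOp (k : ℤ) :
    HasPositionCommutator (shiftOp k) ((k : ℂ) • shiftOp k) := fun φ ξ hξ n => by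
  rw [_root_.smul_apply, EllTwo.smul_apply, shiftOp_apply, shiftOp_apply, hξ]
  push_cast
  ring

theorem JacobiMatrix.hasPositionCommutator_op (J : JacobiMatrix) :
    HasPositionCommutator J.op J.velocity := fun φ ξ hξ n => by
  rw [J.op_apply, J.op_apply, J.velocity_apply]
  simp only [hξ]
  push_cast
  ring

/-! ### A weighted coefficient norm on polynomials. -/

namespace Polynomial

/-- The weighted `ℓ¹` norm `∑ |cₖ| ρᵏ` of the coefficients of a polynomial. -/
def weightedNorm (ρ : ℝ) (p : ℂ[X]) : ℝ := p.sum fun k c => ‖c‖ * ρ ^ k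

theorem weightedNorm_eq_sum_range (ρ : ℝ) {p : ℂ[X]} {N : ℕ} (h : p.natDegree < N) :
    weightedNorm ρ p = ∑ k ∈ Finset.range N, ‖p.coeff k‖ * ρ ^ k :=
  p.sum_over_range' (fun k => by simp) N h

theorem weightedNorm_zero (ρ : ℝ) : weightedNorm ρ 0 = 0 := by simp [weightedNorm]

theorem weightedNorm_one (ρ : ℝ) : weightedNorm ρ 1 = 1 := by
  rw [weightedNorm_eq_sum_range ρ (N := 1) (by simp)]
  simp

theorem weightedNorm_add_le {ρ : ℝ} (hρ : 0 ≤ ρ) (p r : ℂ[X]) :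
    weightedNorm ρ (p + r) ≤ weightedNorm ρ p + weightedNorm ρ r := by
  have h1 : (p + r).natDegree < max p.natDegree r.natDegree + 1 :=
    Nat.lt_succ_of_le (natDegree_add_le p r)
  rw [weightedNorm_eq_sum_range ρ h1,
    weightedNorm_eq_sum_range ρ (Nat.lt_succ_of_le (le_max_left p.natDegree r.natDegree)),
    weightedNorm_eq_sum_range ρ (Nat.lt_succ_of_le (le_max_right p.natDegree r.natDegree)),
    ← Finset.sum_add_distrib]
  refine Finset.sum_le_sum fun k _ => ?_
  rw [coeff_add, ← add_mul]
  gcongr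
  exact norm_add_le _ _

theorem weightedNorm_C_mul (ρ : ℝ) (c : ℂ) (p : ℂ[X]) :
    weightedNorm ρ (C c * p) = ‖c‖ * weightedNorm ρ p := by
  rw [weightedNorm_eq_sum_range ρ (Nat.lt_succ_of_le (natDegree_C_mul_le c p)),
    weightedNorm_eq_sum_range ρ (Nat.lt_succ_self _), Finset.mul_sum]
  simp [mul_assoc]

theorem weightedNorm_X_mul (ρ : ℝ) (p : ℂ[X]) :
    weightedNorm ρ (X * p) = ρ * weightedNorm ρ p := by
  have h : (X * p).natDegree < p.natDegree + 1 + 1 := by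
    have := natDegree_mul_le (p := X) (q := p)
    have := natDegree_X_le (R := ℂ)
    omega
  rw [weightedNorm_eq_sum_range ρ h, weightedNorm_eq_sum_range ρ (Nat.lt_succ_self _),
    Finset.sum_range_succ', Finset.mul_sum]
  simp only [coeff_X_mul, coeff_X_mul_zero, norm_zero, zero_mul, add_zero]
  refine Finset.sum_congr rfl fun k _ => ?_
  ring

theorem weightedNorm_nonneg {ρ : ℝ} (hρ : 0 ≤ ρ) (p : ℂ[X]) : 0 ≤ weightedNorm ρ p :=
  Finset.sum_nonneg fun k _ => by positivity

end Polynomial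

/-! ### Time averages of derivations on polynomials of the generator. -/

section PolynomialAverage

variable {H : Type*} [NormedAddCommGroup H] [InnerProductSpace ℂ H] [CompleteSpace H]

/-- The value at `Aᵏ` of the derivation that maps `A` to `G`. -/
def derivPow (A G : H →L[ℂ] H) : ℕ → (H →L[ℂ] H)
  | 0 => 0
  | k + 1 => A * derivPow A G k + G * A ^ k

/-- The value at `p(A)` of the derivation that maps `A` to `G`. -/
def derivPoly (A G : H →L[ℂ] H) (p : ℂ[X]) : H →L[ℂ] H := p.sum fun k c => c • derivPow A G k

theorem norm_pow_commutator_le {A K : H →L[ℂ] H} {R δ : ℝ} (hR : 1 ≤ R) (hA : ‖A‖ ≤ R)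
    (hK : ‖A * K - K * A‖ ≤ δ) (k : ℕ) : ‖A ^ k * K - K * A ^ k‖ ≤ k * R ^ k * δ := by
  have hδ : 0 ≤ δ := (norm_nonneg _).trans hK
  induction k with
  | zero => simp
  | succ k ih =>
    have h : A ^ (k + 1) * K - K * A ^ (k + 1)
        = A * (A ^ k * K - K * A ^ k) + (A * K - K * A) * A ^ k := by
      rw [pow_succ']
      noncomm_ring
    have h1 : ‖A * (A ^ k * K - K * A ^ k)‖ ≤ R * (k * R ^ k * δ) := norm_mul_le_of_le hA ih
    have h2 : ‖(A * K - K * A) * A ^ k‖ ≤ δ * R ^ k := by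
      rcases subsingleton_or_nontrivial H with hs | hs
      · have : (A * K - K * A) * A ^ k = 0 := Subsingleton.elim _ _
        rw [this, norm_zero]
        positivity
      · exact norm_mul_le_of_le hK ((norm_pow_le _ _).trans (by gcongr))
    have h3 : δ * R ^ k * 1 ≤ δ * R ^ k * R := by gcongr
    rw [h]
    refine (norm_add_le _ _).trans ((add_le_add h1 h2).trans ?_)
    push_cast
    rw [pow_succ]
    linarith

/-- The derivation sends `A^k` to the sum of the `A^i G A^{k-1-i}`. Powers of `A` pass through the
average, leaving `A^i (timeAvg A G t) A^{k-1-i}`; moving the right-hand powers to the left costs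
only commutators with the averaged operator. -/
theorem norm_timeAvg_derivPow_sub_le {A G : H →L[ℂ] H} {R δ t : ℝ} (hR : 1 ≤ R) (hA : ‖A‖ ≤ R)
    (hK : ‖A * timeAvg A G t - timeAvg A G t * A‖ ≤ δ) (k : ℕ) :
    ‖timeAvg A (derivPow A G k) t - (k : ℂ) • (A ^ (k - 1) * timeAvg A G t)‖
      ≤ k ^ 2 * R ^ k * δ := by
  have hδ : 0 ≤ δ := (norm_nonneg _).trans hK
  induction k with
  | zero =>
    have h : timeAvg A (0 : H →L[ℂ] H) t = 0 := by simpa using timeAvg_smul A 0 0 t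
    simp [derivPow, h]
  | succ k ih =>
    have h0 : A * ((k : ℂ) • (A ^ (k - 1) * timeAvg A G t)) = (k : ℂ) • (A ^ k * timeAvg A G t) := by
      rcases k with _ | k
      · simp
      · rw [mul_smul_comm, ← mul_assoc, Nat.add_sub_cancel, ← pow_succ']
    have h : timeAvg A (derivPow A G (k + 1)) t
          - ((k + 1 : ℕ) : ℂ) • (A ^ (k + 1 - 1) * timeAvg A G t)
        = A * (timeAvg A (derivPow A G k) t - (k : ℂ) • (A ^ (k - 1) * timeAvg A G t))
          - (A ^ k * timeAvg A G t - timeAvg A G t * A ^ k) := by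
      rw [derivPow, timeAvg_add, timeAvg_mul_left (Commute.refl A),
        timeAvg_mul_right ((Commute.refl A).pow_left k), mul_sub, h0, Nat.add_sub_cancel]
      push_cast
      rw [add_smul, one_smul]
      abel
    have h1 := norm_mul_le_of_le hA ih
    have h2 := norm_pow_commutator_le hR hA hK k
    have h3 : (k : ℝ) * R ^ k * δ * 1 ≤ k * R ^ k * δ * R := by gcongr
    have h4 : 0 ≤ ((k : ℝ) + 1) * (R ^ k * R) * δ := by positivity
    rw [h]
    refine (norm_sub_le _ _).trans ((add_le_add h1 h2).trans ?_)
    push_cast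
    rw [pow_succ R]
    linarith

theorem sq_le_four_pow (k : ℕ) : (k : ℝ) ^ 2 ≤ 4 ^ k := by
  have h : (k : ℝ) ≤ 2 ^ k := by exact_mod_cast (Nat.lt_two_pow_self (n := k)).le
  calc (k : ℝ) ^ 2 ≤ (2 ^ k) ^ 2 := by gcongr
    _ = 4 ^ k := by rw [← pow_mul, mul_comm, pow_mul]; norm_num

theorem timeAvg_sum {ι : Type*} (A : H →L[ℂ] H) (s : Finset ι) (K : ι → (H →L[ℂ] H)) (t : ℝ) :
    timeAvg A (∑ i ∈ s, K i) t = ∑ i ∈ s, timeAvg A (K i) t := by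
  classical
  induction s using Finset.induction_on with
  | empty => simpa using timeAvg_smul A 0 0 t
  | insert i s hi ih => rw [Finset.sum_insert hi, Finset.sum_insert hi, timeAvg_add, ih]

theorem aeval_derivative_eq_sum {V : Type*} [NormedAddCommGroup V] [NormedSpace ℂ V]
    (A : V →L[ℂ] V) (p : ℂ[X]) :
    aeval A (derivative p) = ∑ k ∈ p.support, p.coeff k • ((k : ℂ) • A ^ (k - 1)) := by
  rw [derivative_apply, Polynomial.sum, map_sum]
  refine Finset.sum_congr rfl fun k _ => ?_
  rw [map_mul, aeval_C, map_pow, aeval_X, smul_smul, ← Algebra.smul_def]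

theorem norm_pow_pred_le {A : H →L[ℂ] H} {R : ℝ} (hR : 1 ≤ R) (hA : ‖A‖ ≤ R) (k : ℕ) :
    ‖(k : ℂ) • A ^ (k - 1)‖ ≤ (4 * R) ^ k := by
  rcases subsingleton_or_nontrivial H with hs | hs
  · have : (k : ℂ) • A ^ (k - 1) = 0 := Subsingleton.elim _ _
    rw [this, norm_zero]
    positivity
  rcases k with _ | k
  · simp
  rw [norm_smul, Complex.norm_natCast, mul_pow, Nat.add_sub_cancel]
  have h1 : ((k + 1 : ℕ) : ℝ) ≤ 4 ^ (k + 1) := by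
    refine le_trans ?_ (sq_le_four_pow (k + 1))
    have : (1 : ℝ) ≤ ((k + 1 : ℕ) : ℝ) := by exact_mod_cast Nat.succ_le_succ (Nat.zero_le k)
    nlinarith
  have h2 : ‖A ^ k‖ ≤ R ^ (k + 1) :=
    ((norm_pow_le _ _).trans (by gcongr)).trans (pow_le_pow_right₀ hR (Nat.le_succ k))
  gcongr

theorem norm_aeval_derivative_le {A : H →L[ℂ] H} {R : ℝ} (hR : 1 ≤ R) (hA : ‖A‖ ≤ R) (p : ℂ[X]) :
    ‖aeval A (derivative p)‖ ≤ weightedNorm (4 * R) p := by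
  rw [aeval_derivative_eq_sum]
  refine norm_sum_le_of_le _ fun k _ => ?_
  rw [norm_smul]
  exact mul_le_mul_of_nonneg_left (norm_pow_pred_le hR hA k) (norm_nonneg _)

/-- Averaging turns the noncommutative derivation into the ordinary derivative `p'(A)`. The radius
`4 * R` absorbs the factor `k ^ 2 ≤ 4 ^ k` from the monomials. -/
theorem norm_timeAvg_derivPoly_sub_le {A G : H →L[ℂ] H} {R δ t : ℝ} (hR : 1 ≤ R) (hA : ‖A‖ ≤ R)
    (hK : ‖A * timeAvg A G t - timeAvg A G t * A‖ ≤ δ) (p : ℂ[X]) :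
    ‖timeAvg A (derivPoly A G p) t - aeval A (derivative p) * timeAvg A G t‖
      ≤ weightedNorm (4 * R) p * δ := by
  have hδ : 0 ≤ δ := (norm_nonneg _).trans hK
  rw [aeval_derivative_eq_sum, derivPoly, Polynomial.sum, timeAvg_sum, Finset.sum_mul,
    ← Finset.sum_sub_distrib, weightedNorm, Polynomial.sum, Finset.sum_mul]
  refine norm_sum_le_of_le _ fun k _ => ?_
  rw [timeAvg_smul, smul_mul_assoc, smul_mul_assoc, ← smul_sub, norm_smul, mul_assoc, mul_pow]
  gcongr
  refine (norm_timeAvg_derivPow_sub_le hR hA hK k).trans ?_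
  gcongr
  exact sq_le_four_pow k

/-- Used to exchange the order of `p'(A)` and the averaged velocity, since both products are needed
when two times are compared. -/
theorem norm_aeval_derivative_commutator_le {A K : H →L[ℂ] H} {R δ : ℝ} (hR : 1 ≤ R)
    (hA : ‖A‖ ≤ R) (hK : ‖A * K - K * A‖ ≤ δ) (p : ℂ[X]) :
    ‖aeval A (derivative p) * K - K * aeval A (derivative p)‖ ≤ weightedNorm (4 * R) p * δ := by
  have hδ : 0 ≤ δ := (norm_nonneg _).trans hK
  rw [aeval_derivative_eq_sum, Finset.sum_mul, Finset.mul_sum, ← Finset.sum_sub_distrib,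
    weightedNorm, Polynomial.sum, Finset.sum_mul]
  refine norm_sum_le_of_le _ fun k _ => ?_
  rw [smul_mul_assoc, mul_smul_comm, ← smul_sub, norm_smul, mul_assoc, mul_pow]
  gcongr
  rw [smul_mul_assoc, mul_smul_comm, ← smul_sub, norm_smul, Complex.norm_natCast]
  rcases k with _ | k
  · simpa using hδ
  rw [Nat.add_sub_cancel]
  have h := norm_pow_commutator_le hR hA hK k
  have h1 : ((k : ℝ) + 1) ^ 2 ≤ 4 ^ (k + 1) := by exact_mod_cast sq_le_four_pow (k + 1)
  calc ((k + 1 : ℕ) : ℝ) * ‖A ^ k * K - K * A ^ k‖ ≤ (k + 1) * ((k + 1) * R ^ (k + 1) * δ) := by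
        push_cast
        gcongr
        refine h.trans ?_
        gcongr
        · linarith
        · exact Nat.le_succ k
    _ = (k + 1) ^ 2 * R ^ (k + 1) * δ := by ring
    _ ≤ 4 ^ (k + 1) * R ^ (k + 1) * δ := by gcongr

end PolynomialAverage

theorem HasPositionCommutator.sum {ι : Type*} (s : Finset ι) {B C : ι → (EllTwo →L[ℂ] EllTwo)}
    (h : ∀ i, HasPositionCommutator (B i) (C i)) :
    HasPositionCommutator (∑ i ∈ s, B i) (∑ i ∈ s, C i) := by
  classical
  induction s using Finset.induction_on with
  | empty => exact HasPositionCommutator.zero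
  | insert i s hi ih =>
    rw [Finset.sum_insert hi, Finset.sum_insert hi]
    exact (h i).add ih

/-- Taking the commutator with `X` is a derivation, so it agrees on polynomials in `A` with the
derivation determined by its value at `A`. -/
theorem HasPositionCommutator.aeval {A G : EllTwo →L[ℂ] EllTwo} (h : HasPositionCommutator A G)
    (p : ℂ[X]) : HasPositionCommutator (aeval A p) (derivPoly A G p) := by
  have h1 : ∀ k, HasPositionCommutator (A ^ k) (derivPow A G k) := fun k => by
    induction k with
    | zero => exact HasPositionCommutator.one
    | succ k ih =>
      rw [pow_succ']
      exact h.mul ih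
  rw [aeval_eq_sum_range, derivPoly, p.sum_over_range (fun k => by simp)]
  exact HasPositionCommutator.sum _ fun k => (h1 k).smul _

/-! ### Transfer polynomials and the discriminant of a periodic Jacobi matrix. -/

namespace JacobiMatrix

variable (J : JacobiMatrix)

/-- Polynomial solutions, in the spectral parameter, of the three-term recurrence of `J`, with
initial values `x` and `y` at `0` and `1`. -/
def recurrencePoly (x y : ℂ[X]) : ℕ → ℂ[X]
  | 0 => x
  | 1 => y
  | n + 2 => C ((J.a (n + 1) : ℂ)⁻¹) * ((X - C (J.b (n + 1) : ℂ)) * recurrencePoly x y (n + 1)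
      - C (J.a n : ℂ) * recurrencePoly x y n)

theorem a_pos (n : ℤ) : 0 < J.a n := by
  obtain ⟨c, hc, h⟩ := J.inf_a_pos
  exact hc.trans_le (h n)

theorem a_ne_zero (n : ℤ) : (J.a n : ℂ) ≠ 0 := by
  exact_mod_cast (J.a_pos n).ne'

/-- The transfer-matrix formula for eigenfunctions, with the spectral parameter replaced by `J`
itself. The vector is quantified inside the induction because the hypothesis is also applied to `J
φ`, which produces the factor `X`. -/
theorem apply_eq_recurrencePoly (n : ℕ) : ∀ φ : EllTwo,
    φ n = aeval J.op (J.recurrencePoly 1 0 n) φ 0 + aeval J.op (J.recurrencePoly 0 1 n) φ 1 := by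
  induction n using Nat.twoStepInduction with
  | zero => intro φ; simp [recurrencePoly]
  | one => intro φ; simp [recurrencePoly]
  | more n ih0 ih1 =>
    intro φ
    have h1 := J.op_apply φ (n + 1)
    have h2 := ih1 (J.op φ)
    push_cast at h2
    have ha := J.a_ne_zero (n + 1)
    have h3 : ∀ p : ℂ[X], aeval J.op p (J.op φ) = aeval J.op (X * p) φ := fun p => by
      rw [mul_comm, map_mul, aeval_X]
      rfl
    have h4 : φ ((n + 2 : ℕ) : ℤ) = (J.a (n + 1) : ℂ)⁻¹ * (J.op φ (n + 1)
        - (J.b (n + 1) : ℂ) * φ (n + 1 : ℕ) - (J.a n : ℂ) * φ n) := by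
      rw [h1]
      push_cast
      rw [add_sub_cancel_right, add_assoc (n : ℤ) 1 1]
      field_simp
      ring_nf
    rw [h4, h2, h3, h3, ih0 φ, ih1 φ]
    simp only [recurrencePoly, map_mul, map_sub, aeval_C, aeval_X, Algebra.algebraMap_eq_smul_one,
      smul_mul_assoc, one_mul, sub_mul, _root_.smul_apply, _root_.sub_apply, EllTwo.smul_apply,
      EllTwo.sub_apply]
    ring

theorem recurrencePoly_wronskian (n : ℕ) :
    C (J.a n : ℂ) * (J.recurrencePoly 0 1 (n + 1) * J.recurrencePoly 1 0 n
      - J.recurrencePoly 0 1 n * J.recurrencePoly 1 0 (n + 1)) = C (J.a 0 : ℂ) := by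
  induction n with
  | zero => simp [recurrencePoly]
  | succ n ih =>
    rw [← ih]
    have h : (C (J.a (n + 1) : ℂ) * C (J.a (n + 1) : ℂ)⁻¹ : ℂ[X]) = 1 := by
      rw [← C_mul, mul_inv_cancel₀ (J.a_ne_zero _), C_1]
    simp only [recurrencePoly, Nat.cast_add, Nat.cast_one]
    linear_combination (C (J.a n : ℂ) * (J.recurrencePoly 0 1 (n + 1) * J.recurrencePoly 1 0 n
      - J.recurrencePoly 0 1 n * J.recurrencePoly 1 0 (n + 1))) * h

/-- Multiplication by `X` costs `ρ`, the coefficients `a` and `b` cost `M` each, and division by `a`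
costs `1 / c`: one factor `K` per step. -/
theorem weightedNorm_recurrencePoly_le {x y : ℂ[X]} {ρ M c K : ℝ} (hρ : 0 ≤ ρ) (hM : ‖J.op‖ ≤ M)
    (hc : 0 < c) (ha : ∀ n, c ≤ J.a n) (hK : 1 ≤ K) (hK' : (ρ + 2 * M) / c ≤ K)
    (hx : weightedNorm ρ x ≤ 1) (hy : weightedNorm ρ y ≤ 1) (n : ℕ) :
    weightedNorm ρ (J.recurrencePoly x y n) ≤ K ^ n := by
  have hM0 : 0 ≤ M := (norm_nonneg _).trans hM
  induction n using Nat.twoStepInduction with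
  | zero => simpa [recurrencePoly] using hx
  | one => simpa [recurrencePoly] using hy.trans hK
  | more n ih0 ih1 =>
    have h1 : (X - C (J.b (n + 1) : ℂ)) * J.recurrencePoly x y (n + 1)
          - C (J.a n : ℂ) * J.recurrencePoly x y n
        = X * J.recurrencePoly x y (n + 1) + (C (-J.b (n + 1) : ℂ) * J.recurrencePoly x y (n + 1)
          + C (-J.a n : ℂ) * J.recurrencePoly x y n) := by
      simp only [map_neg]
      ring
    have h2 : weightedNorm ρ ((X - C (J.b (n + 1) : ℂ)) * J.recurrencePoly x y (n + 1)
          - C (J.a n : ℂ) * J.recurrencePoly x y n) ≤ (ρ + 2 * M) * K ^ (n + 1) := by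
      rw [h1]
      refine (weightedNorm_add_le hρ _ _).trans
        ((add_le_add_right (weightedNorm_add_le hρ _ _) _).trans ?_)
      rw [weightedNorm_X_mul, weightedNorm_C_mul, weightedNorm_C_mul, norm_neg, norm_neg,
        Complex.norm_real, Complex.norm_real, Real.norm_eq_abs, Real.norm_eq_abs]
      have h3 : ρ * weightedNorm ρ (J.recurrencePoly x y (n + 1)) ≤ ρ * K ^ (n + 1) := by gcongr
      have h4 : |J.b (n + 1)| * weightedNorm ρ (J.recurrencePoly x y (n + 1)) ≤ M * K ^ (n + 1) :=
        mul_le_mul ((J.abs_b_le _).trans hM) ih1 (weightedNorm_nonneg hρ _) hM0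
      have h5 : |J.a n| * weightedNorm ρ (J.recurrencePoly x y n) ≤ M * K ^ (n + 1) :=
        mul_le_mul ((J.abs_a_le _).trans hM) (ih0.trans (pow_le_pow_right₀ hK (Nat.le_succ n)))
          (weightedNorm_nonneg hρ _) hM0
      linarith
    have h6 : ‖(J.a (n + 1) : ℂ)⁻¹‖ ≤ c⁻¹ := by
      rw [norm_inv, Complex.norm_real, Real.norm_of_nonneg (J.a_pos _).le]
      exact inv_anti₀ hc (ha _)
    rw [recurrencePoly, weightedNorm_C_mul]
    calc _ ≤ c⁻¹ * ((ρ + 2 * M) * K ^ (n + 1)) :=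
          mul_le_mul h6 h2 (weightedNorm_nonneg hρ _) (by positivity)
      _ = (ρ + 2 * M) / c * K ^ (n + 1) := by ring
      _ ≤ K * K ^ (n + 1) := by gcongr
      _ = K ^ (n + 2) := by ring

variable {J}

theorem IsPeriodic.commute_op {q : ℕ} (h : J.IsPeriodic q) : Commute (shiftOp q) J.op := by
  ext φ n
  change shiftOp q (J.op φ) n = J.op (shiftOp q φ) n
  have h1 := (h.2 (n - 1)).1
  rw [sub_add_eq_add_sub] at h1
  rw [shiftOp_apply, op_apply, op_apply, shiftOp_apply, shiftOp_apply, shiftOp_apply, (h.2 n).1,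
    (h.2 n).2, h1, sub_add_eq_add_sub, add_right_comm n]

theorem IsPeriodic.commute_velocity {q : ℕ} (h : J.IsPeriodic q) :
    Commute (shiftOp q) J.velocity := by
  ext φ n
  change shiftOp q (J.velocity φ) n = J.velocity (shiftOp q φ) n
  have h1 := (h.2 (n - 1)).1
  rw [sub_add_eq_add_sub] at h1
  rw [shiftOp_apply, velocity_apply, velocity_apply, shiftOp_apply, shiftOp_apply, (h.2 n).1,
    h1, sub_add_eq_add_sub, add_right_comm]

theorem commute_shiftOp_neg {B : EllTwo →L[ℂ] EllTwo} {k : ℤ} (h : Commute (shiftOp k) B) :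
    Commute (shiftOp (-k)) B := by
  have h1 : shiftOp (-k) * shiftOp k = 1 := by
    ext φ n
    change shiftOp (-k) (shiftOp k φ) n = φ n
    simp
  have h2 : shiftOp k * shiftOp (-k) = 1 := by
    ext φ n
    change shiftOp k (shiftOp (-k) φ) n = φ n
    simp
  calc shiftOp (-k) * B = shiftOp (-k) * B * (shiftOp k * shiftOp (-k)) := by rw [h2, mul_one]
    _ = shiftOp (-k) * (B * shiftOp k) * shiftOp (-k) := by simp only [mul_assoc]
    _ = (shiftOp (-k) * shiftOp k) * B * shiftOp (-k) := by rw [← h.eq]; simp only [mul_assoc]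
    _ = B * shiftOp (-k) := by rw [h1, one_mul]

/-- An operator commuting with `J` vanishes once its values vanish at the sites `0` and `1`. -/
theorem eq_zero_of_commute {E : EllTwo →L[ℂ] EllTwo} (hE : Commute E J.op)
    (h0 : ∀ φ, E φ 0 = 0) (h1 : ∀ φ, E φ 1 = 0) : E = 0 := by
  have hc : ∀ φ n, (J.a (n - 1) : ℂ) * E φ (n - 1) + (J.b n : ℂ) * E φ n
      + (J.a n : ℂ) * E φ (n + 1) = E (J.op φ) n := fun φ n => by
    rw [← op_apply]
    exact congrArg (fun B : EllTwo →L[ℂ] EllTwo => B φ n) hE.eq.symm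
  have key : ∀ n : ℤ, (∀ φ, E φ n = 0) ∧ ∀ φ, E φ (n + 1) = 0 := fun n => by
    induction n using Int.induction_on with
    | zero => exact ⟨h0, h1⟩
    | succ n ih =>
      refine ⟨ih.2, fun φ => ?_⟩
      have h := hc φ (n + 1)
      rw [add_sub_cancel_right, ih.1, ih.2, ih.2] at h
      simpa [J.a_ne_zero] using h
    | pred n ih =>
      rw [sub_add_cancel]
      refine ⟨fun φ => ?_, ih.1⟩
      have h := hc φ (-n)
      rw [ih.1, ih.1, ih.2] at h
      simpa [J.a_ne_zero] using h
  ext φ n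
  exact (key n).1 φ

/-- The discriminant of a periodic Jacobi matrix: a polynomial `p` with `p(J) = S^q + S^{-q}`. -/
theorem IsPeriodic.exists_discriminant {q : ℕ} (h : J.IsPeriodic q) {ρ M c K : ℝ} (hρ : 0 ≤ ρ)
    (hM : ‖J.op‖ ≤ M) (hc : 0 < c) (ha : ∀ n, c ≤ J.a n) (hK : 1 ≤ K)
    (hK' : (ρ + 2 * M) / c ≤ K) :
    ∃ p : ℂ[X], aeval J.op p = shiftOp q + shiftOp (-q) ∧ weightedNorm ρ p ≤ (2 * K ^ 2) ^ q := by
  set r : ℕ → ℂ[X] := J.recurrencePoly 1 0 with hr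
  set s : ℕ → ℂ[X] := J.recurrencePoly 0 1 with hs
  -- The transfer matrix over one period has determinant one, because `a_q = a_0`.
  have hw : s (q + 1) * r q - s q * r (q + 1) = 1 := by
    have h1 := J.recurrencePoly_wronskian q
    have h2 : J.a q = J.a 0 := by simpa using (h.2 0).1
    rw [h2] at h1
    exact mul_left_cancel₀ (C_ne_zero.2 (J.a_ne_zero 0)) (h1.trans (mul_one _).symm)
  have hS := h.commute_op
  have hS' := commute_shiftOp_neg hS
  have hP : ∀ (k : ℤ) (_ : Commute (shiftOp k) J.op) (p : ℂ[X]) (φ : EllTwo),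
      aeval J.op p (shiftOp k φ) = shiftOp k (aeval J.op p φ) := fun k hk p φ => by
    have : Commute (shiftOp k) (aeval J.op p) := by
      rw [aeval_eq_sum_range]
      exact Commute.sum_right _ _ _ fun i _ => (hk.pow_right i).smul_right _
    exact congrArg (fun B : EllTwo →L[ℂ] EllTwo => B φ) this.eq.symm
  have hmul : ∀ (p p' : ℂ[X]) (φ : EllTwo),
      aeval J.op p (aeval J.op p' φ) = aeval J.op (p * p') φ := fun p p' φ => by
    rw [map_mul]
    rfl
  have e0 : ∀ φ : EllTwo, φ q = aeval J.op (r q) φ 0 + aeval J.op (s q) φ 1 :=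
    J.apply_eq_recurrencePoly q
  have e1 : ∀ φ : EllTwo, φ (q + 1) = aeval J.op (r (q + 1)) φ 0 + aeval J.op (s (q + 1)) φ 1 :=
    fun φ => by simpa using J.apply_eq_recurrencePoly (q + 1) φ
  have hsh : ∀ φ : EllTwo, shiftOp q (shiftOp (-q) φ) = φ := fun φ => by ext n; simp
  have hat0 : ∀ (φ : EllTwo) (p : ℂ[X]), aeval J.op p φ 0
      = aeval J.op (r q * p) (shiftOp (-q) φ) 0 + aeval J.op (s q * p) (shiftOp (-q) φ) 1 :=
    fun φ p => by
      rw [← hmul, ← hmul, ← e0]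
      nth_rw 1 [← hsh φ]
      rw [hP _ hS, shiftOp_apply, zero_add]
  have hat1 : ∀ (φ : EllTwo) (p : ℂ[X]), aeval J.op p φ 1
      = aeval J.op (r (q + 1) * p) (shiftOp (-q) φ) 0
        + aeval J.op (s (q + 1) * p) (shiftOp (-q) φ) 1 :=
    fun φ p => by
      rw [← hmul, ← hmul, ← e1]
      nth_rw 1 [← hsh φ]
      rw [hP _ hS, shiftOp_apply, add_comm]
  have hwi : ∀ (φ : EllTwo) (i : ℤ), aeval J.op (s (q + 1) * r q) (shiftOp (-q) φ) i
      - aeval J.op (s q * r (q + 1)) (shiftOp (-q) φ) i = shiftOp (-q) φ i := fun φ i => by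
    have c0 := congrArg (fun p => aeval J.op p (shiftOp (-q) φ) i) hw
    simp only [map_sub, map_one, _root_.sub_apply, EllTwo.sub_apply] at c0
    exact c0
  -- The witness is the trace of the transfer matrix. The identity is Cayley-Hamilton for
  -- determinant one, checked at the sites `0` and `1`; commutation with `J` propagates it to all
  -- sites.
  refine ⟨r q + s (q + 1), ?_, ?_⟩
  · rw [← sub_eq_zero]
    refine eq_zero_of_commute (J := J) ?_ ?_ ?_
    · refine Commute.sub_left ?_ (hS.add_left hS')
      have h1 : Commute (aeval J.op (r q + s (q + 1))) (aeval J.op (X : ℂ[X])) := by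
        rw [Commute, SemiconjBy, ← map_mul, ← map_mul, mul_comm]
      rwa [aeval_X] at h1
    · intro φ
      have c0 := hat0 φ (s (q + 1))
      have c1 := hat1 φ (s q)
      have c2 := hwi φ 0
      rw [mul_comm] at c2
      rw [mul_comm (s (q + 1)) (s q), mul_comm (r (q + 1))] at c1
      simp only [map_add, _root_.sub_apply, _root_.add_apply, EllTwo.sub_apply, EllTwo.add_apply,
        shiftOp_apply, zero_add] at c2 ⊢
      linear_combination c0 - c1 + c2 - e0 φ
    · intro φ
      have c0 := hat0 φ (r (q + 1))
      have c1 := hat1 φ (r q)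
      have c2 := hwi φ 1
      rw [mul_comm (r (q + 1))] at c1
      have c3 := e1 φ
      rw [add_comm] at c3
      simp only [map_add, _root_.sub_apply, _root_.add_apply, EllTwo.sub_apply, EllTwo.add_apply,
        shiftOp_apply] at c2 ⊢
      linear_combination c1 - c0 + c2 - c3
  · have h1 := J.weightedNorm_recurrencePoly_le (x := 1) (y := 0) hρ hM hc ha hK hK'
      (weightedNorm_one ρ).le ((weightedNorm_zero ρ).le.trans zero_le_one) q
    have h2 := J.weightedNorm_recurrencePoly_le (x := 0) (y := 1) hρ hM hc ha hK hK'
      ((weightedNorm_zero ρ).le.trans zero_le_one) (weightedNorm_one ρ).le (q + 1)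
    have hq := h.1
    calc weightedNorm ρ (r q + s (q + 1)) ≤ K ^ q + K ^ (q + 1) :=
          (weightedNorm_add_le hρ _ _).trans (add_le_add h1 h2)
      _ ≤ K ^ (2 * q) + K ^ (2 * q) := by
          gcongr
          all_goals first | exact hK | omega
      _ = 2 * (K ^ 2) ^ q := by rw [pow_mul]; ring
      _ ≤ 2 ^ q * (K ^ 2) ^ q := by
          gcongr
          exact le_self_pow₀ one_le_two hq.ne'
      _ = _ := by rw [mul_pow]

end JacobiMatrix

/-! ### Averaged velocities of periodic Jacobi matrices. -/

namespace JacobiMatrix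

variable {J : JacobiMatrix}

/-- For a `q`-periodic `J` there is a bounded operator `D` (the derivative of the discriminant at
`J`) that intertwines, up to `O(1/t)`, the averaged velocity with `q (S^q - S^{-q})`. -/
theorem IsPeriodic.exists_discriminant_derivative {q : ℕ} (h : J.IsPeriodic q) {M c K : ℝ}
    (hM1 : 1 ≤ M) (hM : ‖J.op‖ ≤ M) (hc : 0 < c) (ha : ∀ n, c ≤ J.a n) (hK : 1 ≤ K)
    (hK' : 6 * M / c ≤ K) :
    ∃ D : EllTwo →L[ℂ] EllTwo, ‖D‖ ≤ (2 * K ^ 2) ^ q ∧ ∀ t : ℝ, 0 < t →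
      ‖D * timeAvg J.op J.velocity t - (q : ℂ) • (shiftOp q - shiftOp (-q))‖
        ≤ (2 * K ^ 2) ^ q * (4 * M / t) ∧
      ‖timeAvg J.op J.velocity t * D - (q : ℂ) • (shiftOp q - shiftOp (-q))‖
        ≤ 2 * (2 * K ^ 2) ^ q * (4 * M / t) := by
  -- `ρ = 4 * M` is the radius in the averaging lemmas with `R = M`; then `ρ + 2 * M = 6 * M`.
  obtain ⟨p, hp, hpn⟩ := h.exists_discriminant (ρ := 4 * M) (by positivity) hM hc ha hK
    (by rwa [← add_mul, show (4 + 2 : ℝ) = 6 by norm_num])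
  -- Both sides are the position commutator of `S^q + S^{-q}`, computed from `p(J)` and from the
  -- shifts.
  have hV : derivPoly J.op J.velocity p = (q : ℂ) • (shiftOp q - shiftOp (-q)) := by
    have h1 := J.hasPositionCommutator_op.aeval p
    rw [hp] at h1
    refine h1.unique ?_
    have h2 := (hasPositionCommutator_shiftOp q).add (hasPositionCommutator_shiftOp (-q))
    convert h2 using 1
    push_cast
    rw [neg_smul, smul_sub, sub_eq_add_neg]
  have hVc : Commute ((q : ℂ) • (shiftOp q - shiftOp (-q))) J.op :=
    (h.commute_op.sub_left (commute_shiftOp_neg h.commute_op)).smul_left _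
  refine ⟨aeval J.op (derivative p), (norm_aeval_derivative_le hM1 hM p).trans hpn,
    fun t ht => ?_⟩
  have hδ : ‖J.op * timeAvg J.op J.velocity t - timeAvg J.op J.velocity t * J.op‖ ≤ 4 * M / t := by
    refine (norm_commutator_timeAvg_le J.isSelfAdjoint_op _ ht).trans ?_
    have := J.norm_velocity_le
    exact div_le_div_of_nonneg_right (by linarith) ht.le
  have h1 := norm_timeAvg_derivPoly_sub_le hM1 hM hδ p
  rw [hV, timeAvg_of_commute hVc ht.ne', norm_sub_rev] at h1
  have h2 := norm_aeval_derivative_commutator_le hM1 hM hδ p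
  have h3 : weightedNorm (4 * M) p * (4 * M / t) ≤ (2 * K ^ 2) ^ q * (4 * M / t) := by gcongr
  refine ⟨h1.trans h3, ?_⟩
  rw [norm_sub_rev] at h2
  have h4 := norm_add_le_of_le h2 h1
  rw [sub_add_sub_cancel] at h4
  linarith

/-- The shift `S^q - S^{-q}` almost annihilates differences of averaged velocities. -/
theorem IsPeriodic.norm_shift_mul_timeAvg_sub_le {q : ℕ} (h : J.IsPeriodic q) {M c K : ℝ}
    (hM1 : 1 ≤ M) (hM : ‖J.op‖ ≤ M) (hc : 0 < c) (ha : ∀ n, c ≤ J.a n) (hK : 1 ≤ K)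
    (hK' : 6 * M / c ≤ K) {t T : ℝ} (ht : 0 < t) (hT : 0 < T) :
    ‖(timeAvg J.op J.velocity t - timeAvg J.op J.velocity T) * (shiftOp q - shiftOp (-q))‖
      ≤ 16 * M ^ 2 * (2 * K ^ 2) ^ q * (1 / t + 1 / T) := by
  obtain ⟨D, hD, hDt⟩ := h.exists_discriminant_derivative hM1 hM hc ha hK hK'
  have hq : (1 : ℝ) ≤ q := by exact_mod_cast h.1
  have hV : ∀ s, 0 < s → ‖timeAvg J.op J.velocity s‖ ≤ 2 * M := fun s hs =>
    (norm_timeAvg_le J.isSelfAdjoint_op _ hs).trans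
      (J.norm_velocity_le.trans (by linarith))
  have hcomm : shiftOp q * timeAvg J.op J.velocity T = timeAvg J.op J.velocity T * shiftOp q := by
    rw [← timeAvg_mul_left h.commute_op, ← timeAvg_mul_right h.commute_op, h.commute_velocity.eq]
  have hcomm' := (Commute.sub_left hcomm (commute_shiftOp_neg hcomm)).smul_left (q : ℂ)
  set V : EllTwo →L[ℂ] EllTwo := (q : ℂ) • (shiftOp q - shiftOp (-q)) with hVdef
  set At := timeAvg J.op J.velocity t
  set AT := timeAvg J.op J.velocity T
  -- The terms `At * D * AT` cancel; `V` commutes with `AT` because the averaged velocity is itself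
  -- `q`-periodic.
  have key : (At - AT) * V = (At * D - V) * AT - At * (D * AT - V) := by
    rw [sub_mul, ← hcomm'.eq]
    noncomm_ring
  have h1 : ‖(At - AT) * V‖ ≤ 16 * M ^ 2 * (2 * K ^ 2) ^ q * (1 / t + 1 / T) := by
    rw [key]
    have e1 := norm_mul_le_of_le (hDt t ht).2 (hV T hT)
    have e2 := norm_mul_le_of_le (hV t ht) (hDt T hT).1
    refine (norm_sub_le _ _).trans ((add_le_add e1 e2).trans ?_)
    have e3 : 0 ≤ M ^ 2 * (2 * K ^ 2) ^ q * (1 / T) := by positivity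
    calc _ = 16 * (M ^ 2 * (2 * K ^ 2) ^ q * (1 / t)) + 8 * (M ^ 2 * (2 * K ^ 2) ^ q * (1 / T)) := by
          ring
      _ ≤ 16 * (M ^ 2 * (2 * K ^ 2) ^ q * (1 / t)) + 16 * (M ^ 2 * (2 * K ^ 2) ^ q * (1 / T)) := by
          linarith
      _ = _ := by ring
  refine le_trans ?_ h1
  rw [hVdef, mul_smul_comm, norm_smul, Complex.norm_natCast]
  exact le_mul_of_one_le_left (norm_nonneg _) hq

end JacobiMatrix

/-- Telescoping decomposition of a basis vector into the range of `S^q - S^{-q}` and a small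
remainder. -/
theorem exists_single_eq_shift_add {q : ℕ} (hq : 0 < q) (m : ℤ) {N : ℕ} (hN : 0 < N) :
    ∃ χ r : EllTwo, (lp.single 2 m (1 : ℂ) : EllTwo) = (shiftOp q - shiftOp (-q)) χ + r ∧
      ‖χ‖ ≤ N ∧ ‖r‖ ^ 2 ≤ (N : ℝ)⁻¹ := by
  set e : ℕ → EllTwo := fun j => lp.single 2 (m - 2 * j * q) (1 : ℂ) with he
  set f : ℕ → EllTwo := fun j => lp.single 2 (m - (2 * j + 1) * q) (1 : ℂ) with hf
  have hfe : ∀ j, (shiftOp q - shiftOp (-q)) (f j) = e (j + 1) - e j := fun j => by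
    have i1 : m - (2 * j + 1) * q - q = m - 2 * ((j + 1 : ℕ) : ℤ) * q := by
      push_cast
      ring
    have i2 : m - (2 * j + 1) * q - -q = m - 2 * j * q := by ring
    rw [_root_.sub_apply, hf, shiftOp_single, shiftOp_single, i1, i2]
  have hsum : ∀ (c : ℂ) (n : ℕ), ∑ j ∈ Finset.range n, (1 - j * c) • (e (j + 1) - e j)
      = (1 - n * c) • e n - e 0 + c • ∑ j ∈ Finset.range n, e (j + 1) := fun c n => by
    induction n with
    | zero => simp
    | succ n ih =>
      rw [Finset.sum_range_succ, Finset.sum_range_succ, ih]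
      push_cast
      module
  have hN' : (N : ℂ) ≠ 0 := by exact_mod_cast hN.ne'
  -- Summation by parts with linearly decreasing weights writes `e 0` as an element of the range
  -- plus the mean of `N` orthonormal vectors, whose squared norm is `1 / N`.
  refine ⟨-∑ j ∈ Finset.range N, (1 - j * (N : ℂ)⁻¹) • f j,
    (N : ℂ)⁻¹ • ∑ j ∈ Finset.range N, e (j + 1), ?_, ?_, ?_⟩
  · have h0 : (lp.single 2 m (1 : ℂ) : EllTwo) = e 0 := by simp [he]
    simp only [map_neg, map_sum, map_smul, hfe]
    rw [hsum, mul_inv_cancel₀ hN', sub_self, zero_smul, zero_sub, h0]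
    abel
  · rw [norm_neg]
    refine (norm_sum_le_of_le _ (n := fun _ => (1 : ℝ)) fun j hj => ?_).trans (by simp)
    rw [norm_smul, hf, lp.norm_single (by norm_num), norm_one, mul_one]
    have h1 : (1 - j * (N : ℂ)⁻¹) = ((1 - j / N : ℝ) : ℂ) := by
      push_cast
      rw [div_eq_mul_inv]
    have h2 : (j : ℝ) ≤ N := by exact_mod_cast (Finset.mem_range.1 hj).le
    have h3 : (j : ℝ) / N ≤ 1 := div_le_one_of_le₀ h2 (Nat.cast_nonneg _)
    have h4 : 0 ≤ (j : ℝ) / N := by positivity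
    rw [h1, Complex.norm_real, Real.norm_eq_abs, abs_le]
    constructor <;> linarith
  · have hinj : Function.Injective fun j : ℕ => m - 2 * ((j + 1 : ℕ) : ℤ) * q := fun i j hij => by
      have hq' : (q : ℤ) ≠ 0 := by exact_mod_cast hq.ne'
      have h1 : 2 * ((i + 1 : ℕ) : ℤ) = 2 * ((j + 1 : ℕ) : ℤ) := by
        refine mul_right_cancel₀ hq' ?_
        linarith
      omega
    have h1 := lp.norm_sum_single (p := 2) (by norm_num) (fun _ : ℤ => (1 : ℂ))
      ((Finset.range N).map ⟨_, hinj⟩)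
    rw [Finset.sum_map, Finset.sum_map] at h1
    simp only [Function.Embedding.coeFn_mk, ENNReal.toReal_ofNat, Real.rpow_ofNat, norm_one,
      one_pow, Finset.sum_const, Finset.card_range, nsmul_eq_mul, mul_one] at h1
    rw [norm_smul, mul_pow, he, h1, norm_inv, Complex.norm_natCast, inv_pow, sq, mul_inv, mul_assoc,
      inv_mul_cancel₀ (by exact_mod_cast hN.ne'), mul_one]

/-- Averaged velocities of a periodic Jacobi matrix at different times are close on basis
vectors. -/
theorem JacobiMatrix.IsPeriodic.norm_timeAvg_sub_single_le {J : JacobiMatrix} {q : ℕ}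
    (h : J.IsPeriodic q) {M c K : ℝ} (hM1 : 1 ≤ M) (hM : ‖J.op‖ ≤ M) (hc : 0 < c)
    (ha : ∀ n, c ≤ J.a n) (hK : 1 ≤ K) (hK' : 6 * M / c ≤ K) {t T : ℝ} (ht : 0 < t) (hT : 0 < T)
    (m : ℤ) {N : ℕ} (hN : 0 < N) :
    ‖(timeAvg J.op J.velocity t - timeAvg J.op J.velocity T) (lp.single 2 m (1 : ℂ))‖
      ≤ 16 * M ^ 2 * (2 * K ^ 2) ^ q * (1 / t + 1 / T) * N ^ 2 + 4 * M / N := by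
  -- Using `N ^ 2` terms makes the remainder at most `1 / N`.
  obtain ⟨χ, r, hχr, hχ, hr⟩ := exists_single_eq_shift_add h.1 m (pow_pos hN 2)
  have hV : ∀ s, 0 < s → ‖timeAvg J.op J.velocity s‖ ≤ 2 * M := fun s hs =>
    (norm_timeAvg_le J.isSelfAdjoint_op _ hs).trans
      (J.norm_velocity_le.trans (by linarith))
  have hr' : ‖r‖ ≤ 1 / N := by
    refine le_of_sq_le_sq ?_ (by positivity)
    rw [div_pow, one_pow, one_div]
    exact_mod_cast hr
  set A := timeAvg J.op J.velocity t - timeAvg J.op J.velocity T with hA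
  have hA1 : ‖A‖ ≤ 4 * M :=
    (norm_sub_le _ _).trans ((add_le_add (hV t ht) (hV T hT)).trans (by linarith))
  have h1 := h.norm_shift_mul_timeAvg_sub_le hM1 hM hc ha hK hK' ht hT
  rw [hχr, map_add]
  have e1 : ‖A ((shiftOp q - shiftOp (-q)) χ)‖
      ≤ 16 * M ^ 2 * (2 * K ^ 2) ^ q * (1 / t + 1 / T) * N ^ 2 := by
    refine ((A * (shiftOp q - shiftOp (-q))).le_opNorm χ).trans ?_
    push_cast at hχ
    gcongr
  have e2 : ‖A r‖ ≤ 4 * M / N := by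
    refine (A.le_opNorm r).trans ?_
    rw [div_eq_mul_one_div]
    gcongr
  exact (norm_add_le _ _).trans (add_le_add e1 e2)

/-- Lower bound for the averaged velocity of a periodic Jacobi matrix. -/
theorem JacobiMatrix.IsPeriodic.norm_shift_apply_le {J : JacobiMatrix} {q : ℕ}
    (h : J.IsPeriodic q) {M c K : ℝ} (hM1 : 1 ≤ M) (hM : ‖J.op‖ ≤ M) (hc : 0 < c)
    (ha : ∀ n, c ≤ J.a n) (hK : 1 ≤ K) (hK' : 6 * M / c ≤ K) {t : ℝ} (ht : 0 < t) (φ : EllTwo) :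
    ‖(shiftOp q - shiftOp (-q)) φ‖
      ≤ (2 * K ^ 2) ^ q * ‖timeAvg J.op J.velocity t φ‖ + (2 * K ^ 2) ^ q * (4 * M / t) * ‖φ‖ := by
  obtain ⟨D, hD, hDt⟩ := h.exists_discriminant_derivative hM1 hM hc ha hK hK'
  have hq : (1 : ℝ) ≤ q := by exact_mod_cast h.1
  have h1 := ((D * timeAvg J.op J.velocity t - (q : ℂ) • (shiftOp q - shiftOp (-q))).le_opNorm
    φ).trans (mul_le_mul_of_nonneg_right (hDt t ht).1 (norm_nonneg φ))
  have h2 : ‖D (timeAvg J.op J.velocity t φ)‖ ≤ (2 * K ^ 2) ^ q * ‖timeAvg J.op J.velocity t φ‖ :=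
    (D.le_opNorm _).trans (by gcongr)
  have h3 : ‖(q : ℂ) • (shiftOp q - shiftOp (-q)) φ‖ ≤ _ :=
    (norm_le_norm_add_norm_sub (D (timeAvg J.op J.velocity t φ)) _).trans (add_le_add h2 h1)
  rw [norm_smul, Complex.norm_natCast] at h3
  exact (le_mul_of_one_le_left (norm_nonneg _) hq).trans h3

/-! ### Gluing the periodic estimates over all time scales for the class `EC(∞)`. -/

namespace JacobiMatrix

/-- Uniform data extracted from membership in `EC(∞)`: periodic approximants with common bounds
whose distance to `J` is super-exponentially small in the next period. -/
theorem ECInfty.exists_approximants {J : JacobiMatrix} (hJ : J.ECInfty) :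
    ∃ (M c K : ℝ) (b : ℕ) (Jn : ℕ → JacobiMatrix) (q : ℕ → ℕ), 1 ≤ M ∧ ‖J.op‖ ≤ M ∧ 0 < c ∧
      1 ≤ K ∧ 6 * M / c ≤ K ∧ 2 ≤ b ∧ 2 * K ^ 2 ≤ b ∧ (∀ n, (Jn n).IsPeriodic (q n)) ∧
      StrictMono q ∧ (∀ n, ‖(Jn n).op‖ ≤ M) ∧ (∀ n k, c ≤ (Jn n).a k) ∧
      ∀ n, ‖J.op - (Jn n).op‖ * (b : ℝ) ^ (9 * q (n + 1)) ≤ 1 := by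
  obtain ⟨c, hc, ha⟩ := J.inf_a_pos
  set M : ℝ := max 1 ‖J.op‖ + 1 with hM
  set K : ℝ := max 1 (6 * M / (c / 2)) with hK
  set b : ℕ := ⌈2 * K ^ 2⌉₊ + 2 with hb
  have hb2 : 2 ≤ b := Nat.le_add_left _ _
  have hbR : (2 : ℝ) ≤ b := by exact_mod_cast hb2
  have hlog : 0 < Real.log b := Real.log_pos (by linarith)
  -- With this `η`, `e^{η q}` is `b^{9q}`. As `b` depends on `J`, membership in `EC(η)` for a single
  -- fixed `η` would not suffice here.
  obtain ⟨-, Jn, q, hper, hdvd, hne, htend⟩ := hJ (9 * Real.log b) (by positivity)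
  have hqpos : ∀ n, 0 < q n := fun n => (hper n).1
  have hmono : StrictMono q := strictMono_nat_of_lt_succ fun n =>
    lt_of_le_of_ne (Nat.le_of_dvd (hqpos _) (hdvd n)) (hne n)
  have hexp : ∀ k : ℕ, Real.exp (9 * Real.log b * k) = (b : ℝ) ^ (9 * k) := fun k => by
    have h1 : 9 * Real.log b * k = ((9 * k : ℕ) : ℝ) * Real.log b := by
      push_cast
      ring
    rw [h1, Real.exp_nat_mul, Real.exp_log (by linarith)]
  have hev := htend.eventually_le_const (u := min 1 (c / 2)) (by positivity)
  obtain ⟨n0, hn0⟩ := eventually_atTop.1 hev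
  have h1 : ∀ n, ‖J.op - (Jn (n + n0)).op‖ * (b : ℝ) ^ (9 * q (n + n0 + 1)) ≤ min 1 (c / 2) :=
    fun n => by
      have := hn0 (n + n0) (Nat.le_add_left _ _)
      rwa [hexp, mul_comm] at this
  have h2 : ∀ n, ‖J.op - (Jn (n + n0)).op‖ ≤ min 1 (c / 2) := fun n =>
    (le_mul_of_one_le_right (norm_nonneg _) (one_le_pow₀ (by linarith))).trans (h1 n)
  refine ⟨M, c / 2, K, b, fun n => Jn (n + n0), fun n => q (n + n0), ?_, ?_, by positivity,
    le_max_left _ _, le_max_right _ _, hb2, ?_, fun n => hper _,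
    hmono.comp (strictMono_id.add_const n0), fun n => ?_, fun n k => ?_, fun n => ?_⟩
  · linarith [le_max_left 1 ‖J.op‖]
  · linarith [le_max_right 1 ‖J.op‖]
  · rw [hb]
    push_cast
    linarith [Nat.le_ceil (2 * K ^ 2)]
  · have h3 := norm_le_norm_add_norm_sub J.op (Jn (n + n0)).op
    linarith [h2 n, min_le_left 1 (c / 2), le_max_right 1 ‖J.op‖]
  · have h3 := (abs_le.1 ((J.abs_a_sub_le (Jn (n + n0)) k).trans (h2 n))).2
    linarith [min_le_right 1 (c / 2), ha k]
  · have h3 := (h1 n).trans (min_le_left _ _)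
    rwa [add_right_comm] at h3

theorem norm_timeAvg_velocity_le (J : JacobiMatrix) {M : ℝ} (hM : ‖J.op‖ ≤ M) {t : ℝ} (ht : 0 < t) :
    ‖timeAvg J.op J.velocity t‖ ≤ 2 * M :=
  (norm_timeAvg_le J.isSelfAdjoint_op _ ht).trans (J.norm_velocity_le.trans (by linarith))

theorem norm_timeAvg_velocity_sub_le (J J' : JacobiMatrix) {M : ℝ} (hM : ‖J.op‖ ≤ M) {t : ℝ}
    (ht : 1 ≤ t) : ‖timeAvg J.op J.velocity t - timeAvg J'.op J'.velocity t‖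
      ≤ (4 * M + 2) * (t * ‖J.op - J'.op‖) := by
  have h1 := norm_timeAvg_sub_le J.isSelfAdjoint_op J'.isSelfAdjoint_op J.velocity J'.velocity
    (zero_lt_one.trans_le ht)
  have h2 := J.norm_velocity_sub_le J'
  have h3 : ‖J.op - J'.op‖ ≤ t * ‖J.op - J'.op‖ := le_mul_of_one_le_left (norm_nonneg _) ht
  have h4 : 2 * t * ‖J.op - J'.op‖ * ‖J.velocity‖ ≤ 2 * t * ‖J.op - J'.op‖ * (2 * M) := by
    gcongr
    linarith [J.norm_velocity_le]
  linarith

/-- Exponents: with `N = b^{2q}` the periodic error is at most of order `b^q · b^{-7q} · N^2 =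
b^{-2q}`, matching `1 / N`. Replacing `J` by `J_n` costs `t ‖J - J_n‖`, and `9 = 7 + 2` keeps it
below `b^{-2q}` up to the end of the window. The rate `b^{-2q}` leaves room for the loss `b^q` in
the lower bound. -/
theorem ECInfty.exists_rates {J : JacobiMatrix} (hJ : J.ECInfty) :
    ∃ (L : ℝ) (b : ℕ) (q : ℕ → ℕ), 0 ≤ L ∧ 2 ≤ b ∧ StrictMono q ∧
      (∀ n t T (φ : EllTwo), (b : ℝ) ^ (7 * q n) ≤ t → t ≤ (b : ℝ) ^ (7 * q (n + 1)) →
        (b : ℝ) ^ (7 * q n) ≤ T → T ≤ (b : ℝ) ^ (7 * q (n + 1)) → (Summable fun k : ℤ => ‖φ k‖) →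
        ‖(timeAvg J.op J.velocity t - timeAvg J.op J.velocity T) φ‖
          ≤ L * ((b : ℝ) ^ (2 * q n))⁻¹ * ∑' k : ℤ, ‖φ k‖) ∧
      ∀ n (φ : EllTwo), ‖(shiftOp (q n) - shiftOp (-q n)) φ‖
        ≤ (b : ℝ) ^ q n * ‖timeAvg J.op J.velocity ((b : ℝ) ^ (7 * q n)) φ‖
          + L * ((b : ℝ) ^ q n)⁻¹ * ‖φ‖ := by
  obtain ⟨M, c, K, b, Jn, q, hM1, hM, hc, hK, hK', hb, hbK, hper, hq, hMn, han, hδ⟩ :=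
    hJ.exists_approximants
  have hb1 : (1 : ℝ) ≤ b := by exact_mod_cast (one_le_two.trans hb)
  have hb0 : (0 : ℝ) < b := by linarith
  have hclose : ∀ n t, 1 ≤ t → t ≤ (b : ℝ) ^ (7 * q (n + 1)) →
      ‖timeAvg J.op J.velocity t - timeAvg (Jn n).op (Jn n).velocity t‖
        ≤ (4 * M + 2) * ((b : ℝ) ^ (2 * q n))⁻¹ := fun n t h1 h2 => by
    refine (J.norm_timeAvg_velocity_sub_le (Jn n) hM h1).trans ?_
    gcongr
    rw [← one_div, le_div_iff₀ (by positivity)]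
    calc t * ‖J.op - (Jn n).op‖ * (b : ℝ) ^ (2 * q n)
        ≤ (b : ℝ) ^ (7 * q (n + 1)) * ‖J.op - (Jn n).op‖ * (b : ℝ) ^ (2 * q (n + 1)) := by
          gcongr
          exact hq.monotone (Nat.le_succ n)
      _ = ‖J.op - (Jn n).op‖ * (b : ℝ) ^ (9 * q (n + 1)) := by ring
      _ ≤ 1 := hδ n
  have hΓ : ∀ n, (2 * K ^ 2) ^ q n ≤ (b : ℝ) ^ q n := fun n => by gcongr
  refine ⟨32 * M ^ 2 + 12 * M + 4, b, q, by positivity, hb, hq, ?_, ?_⟩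
  · intro n t T φ ht ht' hT hT' hφ
    refine EllTwo.norm_apply_le_of_single (fun m => ?_) hφ
    have hτ : (1 : ℝ) ≤ (b : ℝ) ^ (7 * q n) := one_le_pow₀ hb1
    have ht0 : 0 < t := by linarith
    have hT0 : 0 < T := by linarith
    have h1 := (hper n).norm_timeAvg_sub_single_le hM1 (hMn n) hc (han n) hK hK' ht0 hT0 m
      (N := b ^ (2 * q n)) (by positivity)
    have h2 := hclose n t (hτ.trans ht) ht'
    have h3 := hclose n T (hτ.trans hT) hT'
    have hs : ‖(lp.single 2 m (1 : ℂ) : EllTwo)‖ = 1 := by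
      rw [lp.norm_single (by norm_num), norm_one]
    have h4 : 16 * M ^ 2 * (2 * K ^ 2) ^ q n * (1 / t + 1 / T) * ((b ^ (2 * q n) : ℕ) : ℝ) ^ 2
        ≤ 32 * M ^ 2 * ((b : ℝ) ^ (2 * q n))⁻¹ := by
      calc _ ≤ 16 * M ^ 2 * (b : ℝ) ^ q n * (1 / (b : ℝ) ^ (7 * q n) + 1 / (b : ℝ) ^ (7 * q n))
            * ((b ^ (2 * q n) : ℕ) : ℝ) ^ 2 := by
            gcongr
        _ = 32 * M ^ 2 * ((b : ℝ) ^ (2 * q n))⁻¹ := by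
            push_cast
            field_simp
            ring
    have h5 : 4 * M / ((b ^ (2 * q n) : ℕ) : ℝ) = 4 * M * ((b : ℝ) ^ (2 * q n))⁻¹ := by
      push_cast
      rw [div_eq_mul_inv]
    set A := timeAvg J.op J.velocity t
    set B := timeAvg J.op J.velocity T
    set A' := timeAvg (Jn n).op (Jn n).velocity t
    set B' := timeAvg (Jn n).op (Jn n).velocity T
    set δ : EllTwo := lp.single 2 m (1 : ℂ)
    have h6 : (A - B) δ = (A - A') δ + ((A' - B') δ - (B - B') δ) := by
      simp only [_root_.sub_apply]
      abel
    have h7 : ‖(A - A') δ‖ ≤ ‖A - A'‖ := by simpa [hs] using (A - A').le_opNorm δ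
    have h8 : ‖(B - B') δ‖ ≤ ‖B - B'‖ := by simpa [hs] using (B - B').le_opNorm δ
    have h9 : ‖(A - B) δ‖ ≤ ‖(A - A') δ‖ + (‖(A' - B') δ‖ + ‖(B - B') δ‖) := by
      rw [h6]
      exact (norm_add_le _ _).trans (add_le_add_right (norm_sub_le _ _) _)
    rw [h5] at h1
    linarith
  · intro n φ
    have hτ : (1 : ℝ) ≤ (b : ℝ) ^ (7 * q n) := one_le_pow₀ hb1
    have h1 := (hper n).norm_shift_apply_le hM1 (hMn n) hc (han n) hK hK'
      (zero_lt_one.trans_le hτ) φ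
    have h2 := hclose n _ hτ (pow_le_pow_right₀ hb1
      (Nat.mul_le_mul_left 7 (hq.monotone (Nat.le_succ n))))
    set A := timeAvg J.op J.velocity ((b : ℝ) ^ (7 * q n))
    set A' := timeAvg (Jn n).op (Jn n).velocity ((b : ℝ) ^ (7 * q n))
    have h3 : ‖A' φ‖ ≤ ‖A φ‖ + (4 * M + 2) * ((b : ℝ) ^ (2 * q n))⁻¹ * ‖φ‖ := by
      have h4 := norm_le_norm_add_norm_sub (A φ) (A' φ)
      have h5 := ((A - A').le_opNorm φ).trans (mul_le_mul_of_nonneg_right h2 (norm_nonneg φ))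
      exact h4.trans (add_le_add_right h5 _)
    calc _ ≤ (b : ℝ) ^ q n * (‖A φ‖ + (4 * M + 2) * ((b : ℝ) ^ (2 * q n))⁻¹ * ‖φ‖)
          + (b : ℝ) ^ q n * (4 * M / (b : ℝ) ^ (7 * q n)) * ‖φ‖ := by
          refine h1.trans ?_
          have := hΓ n
          gcongr
      _ ≤ (b : ℝ) ^ q n * (‖A φ‖ + (4 * M + 2) * ((b : ℝ) ^ (2 * q n))⁻¹ * ‖φ‖)
          + (b : ℝ) ^ q n * (4 * M / (b : ℝ) ^ (2 * q n)) * ‖φ‖ := by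
          gcongr
          all_goals first | exact hb1 | norm_num
      _ = (b : ℝ) ^ q n * ‖A φ‖ + (8 * M + 2) * ((b : ℝ) ^ q n)⁻¹ * ‖φ‖ := by
          field_simp
          ring
      _ ≤ _ := by
          have : 8 * M + 2 ≤ 32 * M ^ 2 + 12 * M + 4 := by nlinarith
          gcongr

/-- Summable sequences have Cauchy averaged velocities, with an explicit rate along a sequence of
times. -/
theorem ECInfty.exists_cauchy_rates {J : JacobiMatrix} (hJ : J.ECInfty) :
    ∃ (L : ℝ) (b : ℕ) (q : ℕ → ℕ), 0 ≤ L ∧ 2 ≤ b ∧ StrictMono q ∧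
      (∀ n t (φ : EllTwo), (b : ℝ) ^ (7 * q n) ≤ t → (Summable fun k : ℤ => ‖φ k‖) →
        ‖timeAvg J.op J.velocity t φ - timeAvg J.op J.velocity ((b : ℝ) ^ (7 * q n)) φ‖
          ≤ L * ((b : ℝ) ^ (2 * q n))⁻¹ * ∑' k : ℤ, ‖φ k‖) ∧
      ∀ n (φ : EllTwo), ‖(shiftOp (q n) - shiftOp (-q n)) φ‖
        ≤ (b : ℝ) ^ q n * ‖timeAvg J.op J.velocity ((b : ℝ) ^ (7 * q n)) φ‖
          + L * ((b : ℝ) ^ q n)⁻¹ * ‖φ‖ := by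
  obtain ⟨L, b, q, hL, hb, hq, hwin, hlow⟩ := hJ.exists_rates
  have hb2 : (2 : ℝ) ≤ b := by exact_mod_cast hb
  have hb1 : (1 : ℝ) ≤ b := by linarith
  have hb0 : (0 : ℝ) < b := by linarith
  refine ⟨3 * L, b, q, by positivity, hb, hq, ?_, fun n φ => (hlow n φ).trans ?_⟩
  swap
  · gcongr
    linarith
  intro n t φ ht hφ
  set ε : ℕ → ℝ := fun n => ((b : ℝ) ^ (2 * q n))⁻¹ with hε
  set τ : ℕ → ℝ := fun n => (b : ℝ) ^ (7 * q n) with hτ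
  set S := ∑' k : ℤ, ‖φ k‖ with hS
  have hS0 : 0 ≤ S := tsum_nonneg fun _ => norm_nonneg _
  have hε0 : ∀ n, 0 ≤ ε n := fun n => by positivity
  have hε1 : ∀ n, 2 * ε (n + 1) ≤ ε n := fun n => by
    have h1 : 2 * q n + 1 ≤ 2 * q (n + 1) := by
      have := hq (Nat.lt_add_one n)
      omega
    have h2 : (b : ℝ) ^ (2 * q n) * 2 ≤ (b : ℝ) ^ (2 * q (n + 1)) :=
      calc (b : ℝ) ^ (2 * q n) * 2 ≤ (b : ℝ) ^ (2 * q n) * b := by gcongr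
        _ = (b : ℝ) ^ (2 * q n + 1) := (pow_succ _ _).symm
        _ ≤ _ := pow_le_pow_right₀ hb1 h1
    have h3 := inv_anti₀ (by positivity) h2
    rw [mul_inv] at h3
    simp only [hε]
    linarith
  have hτm : Monotone τ := fun i j hij =>
    pow_le_pow_right₀ hb1 (Nat.mul_le_mul_left 7 (hq.monotone hij))
  set A := fun t => timeAvg J.op J.velocity t φ with hA
  have hw : ∀ n t T, τ n ≤ t → t ≤ τ (n + 1) → τ n ≤ T → T ≤ τ (n + 1) →
      ‖A t - A T‖ ≤ L * ε n * S := fun n t T h1 h2 h3 h4 => hwin n t T φ h1 h2 h3 h4 hφ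
  -- Since `ε` at least halves at each step, `ε (n + k)` is at most `2 * (ε (n + k) - ε (n + k +
  -- 1))`, so the window errors telescope.
  have hstep : ∀ k, ‖A (τ (n + k)) - A (τ n)‖ ≤ 2 * L * (ε n - ε (n + k)) * S := fun k => by
    induction k with
    | zero => simp
    | succ k ih =>
      have h1 := hw (n + k) (τ (n + k + 1)) (τ (n + k)) (hτm (Nat.le_succ _)) le_rfl le_rfl
        (hτm (Nat.le_succ _))
      have h2 := norm_sub_le_norm_sub_add_norm_sub (A (τ (n + k + 1))) (A (τ (n + k))) (A (τ n))
      have h3 : L * S * (2 * ε (n + k + 1)) ≤ L * S * ε (n + k) := by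
        have := hε1 (n + k)
        gcongr
      rw [← add_assoc]
      linarith
  obtain ⟨k, hk⟩ : ∃ k, t ≤ τ (n + k) := by
    obtain ⟨k, hk⟩ := exists_nat_ge t
    refine ⟨k, hk.trans ?_⟩
    have h1 : k ≤ 7 * q (n + k) := by
      have := hq.le_apply (x := n + k)
      omega
    have h2 : k ≤ b ^ (7 * q (n + k)) :=
      (Nat.lt_pow_self (by omega)).le.trans (Nat.pow_le_pow_right (by omega) h1)
    simp only [hτ]
    exact_mod_cast h2
  -- Full windows contribute at most `2 * L`; the last, incomplete one adds a further `L`.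
  have hfin : ∀ k t, τ n ≤ t → t ≤ τ (n + k) → ‖A t - A (τ n)‖ ≤ 3 * L * ε n * S := fun k => by
    induction k with
    | zero =>
      intro t h1 h2
      rw [le_antisymm h2 h1, add_zero, sub_self, norm_zero]
      have := hε0 n
      positivity
    | succ k ih =>
      intro t h1 h2
      rcases le_total t (τ (n + k)) with h3 | h3
      · exact ih t h1 h3
      have h4 := hw (n + k) t (τ (n + k)) h3 h2 le_rfl (hτm (Nat.le_succ _))
      have h5 := norm_sub_le_norm_sub_add_norm_sub (A t) (A (τ (n + k))) (A (τ n))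
      have h6 := hstep k
      have h7 : L * S * ε (n + k) ≤ L * S * ε n := by
        have : Antitone ε := antitone_nat_of_succ_le fun n => by linarith [hε1 n, hε0 (n + 1)]
        have := this (Nat.le_add_right n k)
        gcongr
      have h8 : 0 ≤ L * S * ε (n + k) := by
        have := hε0 (n + k)
        positivity
      linarith
  exact hfin k t ht hk

theorem ECInfty.exists_limit {J : JacobiMatrix} (hJ : J.ECInfty) :
    ∃ A : EllTwo →L[ℂ] EllTwo,
      (∀ φ, Tendsto (fun t => timeAvg J.op J.velocity t φ) atTop (𝓝 (A φ))) ∧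
      ∀ φ, (Summable fun k : ℤ => ‖φ k‖) → A φ = 0 → φ = 0 := by
  obtain ⟨L, b, q, hL, hb, hq, hrate, hlow⟩ := hJ.exists_cauchy_rates
  have hb2 : (2 : ℝ) ≤ b := by exact_mod_cast hb
  have hb1 : (1 : ℝ) < b := by linarith
  have hinv : Tendsto (fun n => ((b : ℝ) ^ q n)⁻¹) atTop (𝓝 0) :=
    ((tendsto_pow_atTop_atTop_of_one_lt hb1).comp hq.tendsto_atTop).inv_tendsto_atTop
  have hpow : ∀ n, ((b : ℝ) ^ (2 * q n))⁻¹ = ((b : ℝ) ^ q n)⁻¹ * ((b : ℝ) ^ q n)⁻¹ := fun n => by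
    rw [two_mul, pow_add, mul_inv]
  have hcauchy1 : ∀ φ : EllTwo, (Summable fun k : ℤ => ‖φ k‖) →
      CauchySeq fun t => timeAvg J.op J.velocity t φ := fun φ hφ => by
    refine Metric.cauchySeq_iff'.2 fun ε hε => ?_
    have h1 : Tendsto (fun n => L * ((b : ℝ) ^ (2 * q n))⁻¹ * ∑' k : ℤ, ‖φ k‖) atTop (𝓝 0) := by
      have := ((hinv.mul hinv).const_mul L).mul_const (∑' k : ℤ, ‖φ k‖)
      simpa only [hpow, mul_zero, zero_mul] using this
    obtain ⟨n, hn⟩ := (h1.eventually_lt_const hε).exists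
    refine ⟨(b : ℝ) ^ (7 * q n), fun t ht => ?_⟩
    rw [dist_eq_norm]
    exact (hrate n t φ ht hφ).trans_lt hn
  -- Finitely supported sequences are dense and the averages are uniformly bounded, so the Cauchy
  -- property extends to all of the space.
  have hcauchy : ∀ φ : EllTwo, CauchySeq fun t => timeAvg J.op J.velocity t φ := fun φ => by
    refine Metric.cauchySeq_iff'.2 fun ε hε => ?_
    set M := ‖J.op‖ with hM
    obtain ⟨s, hs⟩ : ∃ s : Finset ℤ,
        ‖φ - ∑ k ∈ s, φ k • (lp.single 2 k (1 : ℂ) : EllTwo)‖ < ε / (3 * (2 * M + 1)) := by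
      have h1 := Metric.tendsto_nhds.1 (EllTwo.hasSum_single φ) (ε / (3 * (2 * M + 1)))
        (by positivity)
      obtain ⟨s, hs⟩ := h1.exists
      exact ⟨s, by rwa [dist_comm, dist_eq_norm] at hs⟩
    set ψ := ∑ k ∈ s, φ k • (lp.single 2 k (1 : ℂ) : EllTwo) with hψ
    have hψs : Summable fun k : ℤ => ‖ψ k‖ := by
      refine summable_of_ne_finset_zero (s := s) fun k hk => ?_
      rw [norm_eq_zero, hψ, lp.coeFn_sum, Finset.sum_apply]
      refine Finset.sum_eq_zero fun j hj => ?_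
      rw [EllTwo.smul_apply, lp.single_apply, Pi.single_eq_of_ne (ne_of_mem_of_not_mem hj hk).symm,
        mul_zero]
    obtain ⟨T, hT⟩ := Metric.cauchySeq_iff.1 (hcauchy1 ψ hψs) (ε / 3) (by positivity)
    have hbd : ∀ t, 0 < t → ‖timeAvg J.op J.velocity t (φ - ψ)‖ ≤ ε / 3 := fun t ht => by
      refine ((timeAvg J.op J.velocity t).le_opNorm _).trans ?_
      calc _ ≤ (2 * M + 1) * (ε / (3 * (2 * M + 1))) := by
            have := J.norm_timeAvg_velocity_le le_rfl ht
            gcongr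
            linarith
        _ = ε / 3 := by
            have : 2 * M + 1 ≠ 0 := by positivity
            field_simp
    refine ⟨max T 1, fun t ht => ?_⟩
    have ht0 : 0 < t := by linarith [le_max_right T 1]
    have hT0 : 0 < max T 1 := by linarith [le_max_right T 1]
    have h1 := hT t (le_of_max_le_left ht) (max T 1) (le_max_left _ _)
    have h2 := hbd t ht0
    have h3 := hbd _ hT0
    rw [map_sub] at h2 h3
    rw [dist_eq_norm] at h1 ⊢
    set x := timeAvg J.op J.velocity t φ
    set y := timeAvg J.op J.velocity t ψ
    set x' := timeAvg J.op J.velocity (max T 1) φ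
    set y' := timeAvg J.op J.velocity (max T 1) ψ
    have h4 : x - x' = (x - y) + ((y - y') - (x' - y')) := by abel
    rw [h4]
    have h5 := norm_add_le (x - y) ((y - y') - (x' - y'))
    have h6 := norm_sub_le (y - y') (x' - y')
    linarith
  choose f hf using fun φ => cauchySeq_tendsto_of_complete (hcauchy φ)
  refine ⟨continuousLinearMapOfTendsto (fun t => timeAvg J.op J.velocity t)
    (tendsto_pi_nhds.2 hf), hf, fun φ hφ h0 => ?_⟩
  have h0' : f φ = 0 := h0
  set S := ∑' k : ℤ, ‖φ k‖ with hS
  have h1 : ∀ n, ‖timeAvg J.op J.velocity ((b : ℝ) ^ (7 * q n)) φ‖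
      ≤ L * ((b : ℝ) ^ (2 * q n))⁻¹ * S := fun n => by
    have h2 := ((hf φ).sub_const (timeAvg J.op J.velocity ((b : ℝ) ^ (7 * q n)) φ)).norm
    rw [h0', zero_sub, norm_neg] at h2
    exact le_of_tendsto h2 ((eventually_ge_atTop _).mono fun t ht => hrate n t φ ht hφ)
  have h2 : ∀ n, ‖(shiftOp (q n) - shiftOp (-q n)) φ‖ ≤ (L * S + L * ‖φ‖) * ((b : ℝ) ^ q n)⁻¹ :=
    fun n => by
      have h3 : (b : ℝ) ^ q n * ‖timeAvg J.op J.velocity ((b : ℝ) ^ (7 * q n)) φ‖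
          ≤ (b : ℝ) ^ q n * (L * ((b : ℝ) ^ (2 * q n))⁻¹ * S) := by
        have := h1 n
        gcongr
      have h4 : (b : ℝ) ^ q n * (L * ((b : ℝ) ^ (2 * q n))⁻¹ * S) = L * S * ((b : ℝ) ^ q n)⁻¹ := by
        rw [hpow]
        field_simp
      linarith [hlow n φ]
  ext j
  -- Evaluated at the site `j - q n`, the shift difference compares `φ j` with a value that escapes
  -- to infinity.
  have h3 : ∀ n, ‖φ j‖ ≤ (L * S + L * ‖φ‖) * ((b : ℝ) ^ q n)⁻¹ + ‖φ (j - 2 * q n)‖ := fun n => by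
    have h4 := lp.norm_apply_le_norm (p := 2) (by norm_num)
      ((shiftOp (q n) - shiftOp (-q n)) φ) (j - q n)
    have h5 : (shiftOp (q n) - shiftOp (-q n)) φ (j - q n) = φ j - φ (j - 2 * q n) := by
      rw [_root_.sub_apply, EllTwo.sub_apply, shiftOp_apply, shiftOp_apply, sub_add_cancel]
      rw [show j - (q n : ℤ) + -(q n : ℤ) = j - 2 * q n by ring]
    rw [h5] at h4
    have h6 := norm_le_norm_add_norm_sub (φ (j - 2 * q n)) (φ j)
    rw [norm_sub_rev] at h6
    linarith [h2 n]
  have h4 : Tendsto (fun n => ‖φ (j - 2 * q n)‖) atTop (𝓝 0) := by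
    have hinj : Function.Injective fun n => j - 2 * (q n : ℤ) := fun m n hmn =>
      hq.injective (by simp only at hmn; omega)
    have h5 := hφ.tendsto_cofinite_zero.comp hinj.tendsto_cofinite
    rwa [Nat.cofinite_eq_atTop] at h5
  have h5 := (hinv.const_mul (L * S + L * ‖φ‖)).add h4
  rw [mul_zero, add_zero] at h5
  exact norm_le_zero_iff.1 (ge_of_tendsto' h5 h3)

end JacobiMatrix

/-! ### Polynomial weights, ballistic upper bounds and the link with the position operator. -/

/-- The polynomial weight `(1 + |n| / T) ^ k`. -/
def polyWeight (T : ℝ) (k : ℕ) (n : ℤ) : ℝ := (1 + |(n : ℝ)| / T) ^ k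

theorem one_le_polyWeight {T : ℝ} (hT : 0 < T) (k : ℕ) (n : ℤ) : 1 ≤ polyWeight T k n :=
  one_le_pow₀ (by
    have : 0 ≤ |(n : ℝ)| / T := by positivity
    linarith)

theorem polyWeight_pos {T : ℝ} (hT : 0 < T) (k : ℕ) (n : ℤ) : 0 < polyWeight T k n :=
  zero_lt_one.trans_le (one_le_polyWeight hT k n)

theorem polyWeight_ne_zero {T : ℝ} (hT : 0 < T) (k : ℕ) (n : ℤ) : (polyWeight T k n : ℂ) ≠ 0 := by
  exact_mod_cast (polyWeight_pos hT k n).ne'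

theorem one_add_pow_le {x : ℝ} (h0 : 0 ≤ x) (h1 : x ≤ 1) (k : ℕ) :
    (1 + x) ^ k ≤ 1 + 2 ^ k * x := by
  -- The sharper chord bound on `[0, 1]` is the one that closes under induction.
  suffices h : (1 + x) ^ k ≤ 1 + (2 ^ k - 1) * x by linarith
  induction k with
  | zero => simp
  | succ k ih =>
    have h2 : (0 : ℝ) ≤ 2 ^ k - 1 := sub_nonneg.2 (one_le_pow₀ one_le_two)
    have h3 : ((2 : ℝ) ^ k - 1) * x * x ≤ (2 ^ k - 1) * x * 1 := by gcongr
    calc (1 + x) ^ (k + 1) ≤ (1 + (2 ^ k - 1) * x) * (1 + x) := by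
          rw [pow_succ]
          gcongr
      _ ≤ 1 + (2 ^ (k + 1) - 1) * x := by
          rw [pow_succ]
          linarith

theorem abs_polyWeight_div_sub_one_le {T : ℝ} (hT : 1 ≤ T) (k : ℕ) {n m : ℤ}
    (h : |(n : ℝ) - m| ≤ 1) : |polyWeight T k n / polyWeight T k m - 1| ≤ 2 ^ k / T := by
  have hT0 : 0 < T := by linarith
  have key : ∀ n m : ℤ, |(n : ℝ) - m| ≤ 1 →
      polyWeight T k n ≤ polyWeight T k m * (1 + 2 ^ k / T) := fun n m h => by
    have h1 : |(n : ℝ)| ≤ |(m : ℝ)| + 1 := by linarith [abs_sub_abs_le_abs_sub (n : ℝ) m]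
    have h2 : 1 + |(n : ℝ)| / T ≤ (1 + |(m : ℝ)| / T) * (1 + 1 / T) := by
      have h3 : |(n : ℝ)| / T ≤ (|(m : ℝ)| + 1) / T := by gcongr
      have h4 : 0 ≤ |(m : ℝ)| / T * (1 / T) := by positivity
      rw [add_div] at h3
      linarith
    have h5 := one_add_pow_le (x := 1 / T) (by positivity) (div_le_one_of_le₀ hT hT0.le) k
    rw [mul_one_div] at h5
    calc polyWeight T k n ≤ ((1 + |(m : ℝ)| / T) * (1 + 1 / T)) ^ k :=
          pow_le_pow_left₀ (by positivity) h2 k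
      _ = polyWeight T k m * (1 + 1 / T) ^ k := mul_pow _ _ _
      _ ≤ _ := mul_le_mul_of_nonneg_left h5 (polyWeight_pos hT0 k m).le
  have hn := polyWeight_pos hT0 k n
  have hm := polyWeight_pos hT0 k m
  have h1 := key n m h
  have h2 := key m n (by rwa [abs_sub_comm])
  have h0 : 0 ≤ 2 ^ k / T := by positivity
  have h3 : polyWeight T k n / polyWeight T k m ≤ 1 + 2 ^ k / T := by
    rw [div_le_iff₀ hm]
    linarith
  have h4 : 1 - 2 ^ k / T ≤ polyWeight T k n / polyWeight T k m := by
    rw [le_div_iff₀ hm]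
    rcases le_total (1 - 2 ^ k / T) 0 with h5 | h5
    · exact (mul_nonpos_of_nonpos_of_nonneg h5 hm.le).trans hn.le
    · calc (1 - 2 ^ k / T) * polyWeight T k m
          ≤ (1 - 2 ^ k / T) * (polyWeight T k n * (1 + 2 ^ k / T)) := by gcongr
        _ = polyWeight T k n - polyWeight T k n * (2 ^ k / T) ^ 2 := by ring
        _ ≤ polyWeight T k n := by
            have : 0 ≤ polyWeight T k n * (2 ^ k / T) ^ 2 := by positivity
            linarith
  rw [abs_le]
  constructor <;> linarith

theorem abs_inv_polyWeight_le {T : ℝ} (hT : 0 < T) (k : ℕ) (n : ℤ) :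
    |(polyWeight T k n)⁻¹| ≤ 1 := by
  rw [abs_of_pos (inv_pos.2 (polyWeight_pos hT k n))]
  exact inv_le_one_of_one_le₀ (one_le_polyWeight hT k n)

/-- Multiplication by the reciprocal of the weight. -/
def invWeight {T : ℝ} (hT : 0 < T) (k : ℕ) : EllTwo →L[ℂ] EllTwo :=
  weightedShift (fun n => (polyWeight T k n)⁻¹) ⟨1, abs_inv_polyWeight_le hT k⟩ 0

theorem invWeight_apply {T : ℝ} (hT : 0 < T) (k : ℕ) (φ : EllTwo) (n : ℤ) :
    invWeight hT k φ n = (polyWeight T k n : ℂ)⁻¹ * φ n := by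
  simp [invWeight, weightedShift_apply]

namespace JacobiMatrix

variable (J : JacobiMatrix)

theorem abs_mul_weight_div_le {T : ℝ} (hT : 1 ≤ T) (k : ℕ) (x : ℤ) {n m : ℤ}
    (h : |(n : ℝ) - m| ≤ 1) :
    |J.a x * (polyWeight T k n / polyWeight T k m - 1)| ≤ ‖J.op‖ * (2 ^ k / T) := by
  rw [abs_mul]
  exact mul_le_mul (J.abs_a_le x) (abs_polyWeight_div_sub_one_le hT k h) (abs_nonneg _)
    (norm_nonneg _)

/-- The perturbation of `J` produced by conjugation with a polynomial weight. -/
def weightPerturbation {T : ℝ} (hT : 1 ≤ T) (k : ℕ) : EllTwo →L[ℂ] EllTwo :=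
  weightedShift (fun n => J.a (n - 1) * (polyWeight T k n / polyWeight T k (n - 1) - 1))
      ⟨_, fun n => J.abs_mul_weight_div_le hT k (n - 1) (by simp)⟩ (-1)
    + weightedShift (fun n => J.a n * (polyWeight T k n / polyWeight T k (n + 1) - 1))
      ⟨_, fun n => J.abs_mul_weight_div_le hT k n (by simp)⟩ 1

theorem norm_weightPerturbation_le {T : ℝ} (hT : 1 ≤ T) (k : ℕ) :
    ‖J.weightPerturbation hT k‖ ≤ 2 * (‖J.op‖ * (2 ^ k / T)) := by
  rw [two_mul]
  exact (norm_add_le _ _).trans (add_le_add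
    (norm_weightedShift_le _ _ fun n => J.abs_mul_weight_div_le hT k (n - 1) (by simp))
    (norm_weightedShift_le _ _ fun n => J.abs_mul_weight_div_le hT k n (by simp)))

theorem op_add_weightPerturbation_apply {T : ℝ} (hT : 1 ≤ T) (k : ℕ) (φ : EllTwo) (n : ℤ) :
    (J.op + J.weightPerturbation hT k) φ n
      = (J.a (n - 1) : ℂ) * (polyWeight T k n / polyWeight T k (n - 1)) * φ (n - 1)
        + (J.b n : ℂ) * φ n
        + (J.a n : ℂ) * (polyWeight T k n / polyWeight T k (n + 1)) * φ (n + 1) := by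
  rw [_root_.add_apply, EllTwo.add_apply, op_apply, weightPerturbation, _root_.add_apply,
    EllTwo.add_apply, weightedShift_apply, weightedShift_apply, ← sub_eq_add_neg]
  push_cast
  ring

/-- Conjugation by the unbounded weight, phrased as an intertwining with its bounded inverse;
`propagator_intertwine` then transfers it to the evolutions. -/
theorem op_mul_invWeight {T : ℝ} (hT : 1 ≤ T) (k : ℕ) :
    J.op * invWeight (zero_lt_one.trans_le hT) k
      = invWeight (zero_lt_one.trans_le hT) k * (J.op + J.weightPerturbation hT k) := by
  have hT0 : 0 < T := zero_lt_one.trans_le hT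
  ext φ n
  change J.op (invWeight hT0 k φ) n = invWeight hT0 k ((J.op + J.weightPerturbation hT k) φ) n
  rw [op_apply, invWeight_apply, invWeight_apply, invWeight_apply, invWeight_apply,
    op_add_weightPerturbation_apply]
  have h1 := polyWeight_ne_zero hT0 k n
  have h2 := polyWeight_ne_zero hT0 k (n - 1)
  have h3 := polyWeight_ne_zero hT0 k (n + 1)
  field_simp

/-- Polynomially weighted norms grow at most at the ballistic rate. -/
theorem exists_weighted_evolution (k : ℕ) {φ χ : EllTwo}
    (hχ : ∀ n, χ n = (polyWeight 1 k n : ℂ) * φ n) {t : ℝ} (ht : 1 ≤ t) :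
    ∃ ξ : EllTwo, ‖ξ‖ ≤ Real.exp (2 * (‖J.op‖ * 2 ^ k)) * ‖χ‖ ∧
      ∀ n, ξ n = (polyWeight t k n : ℂ) * J.evolution t φ n := by
  have ht0 : 0 < t := zero_lt_one.trans_le ht
  have hb : ∀ n, |polyWeight t k n / polyWeight 1 k n| ≤ 1 := fun n => by
    rw [abs_of_pos (div_pos (polyWeight_pos ht0 k n) (polyWeight_pos one_pos k n)),
      div_le_one (polyWeight_pos one_pos k n)]
    refine pow_le_pow_left₀ (by positivity) ?_ k
    gcongr
  -- This is `φ` with the weight at scale `T = t`. At that scale the perturbation is `O(1/t)`, so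
  -- the growth up to time `t` is bounded independently of `t`.
  set η : EllTwo := weightedShift (fun n => polyWeight t k n / polyWeight 1 k n) ⟨1, hb⟩ 0 χ with hη
  have hφ : φ = invWeight ht0 k η := by
    ext n
    rw [invWeight_apply, hη, weightedShift_apply, add_zero, hχ]
    have h1 := polyWeight_ne_zero ht0 k n
    have h2 := polyWeight_ne_zero one_pos k n
    push_cast
    field_simp
  have hη1 : ‖η‖ ≤ ‖χ‖ := by
    refine (ContinuousLinearMap.le_opNorm _ _).trans ?_
    exact mul_le_of_le_one_left (norm_nonneg _) (norm_weightedShift_le _ _ hb)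
  have hint := propagator_intertwine (J.op_mul_invWeight ht k) t
  refine ⟨propagator (J.op + J.weightPerturbation ht k) t η, ?_, fun n => ?_⟩
  · refine (ContinuousLinearMap.le_opNorm _ _).trans (mul_le_mul ?_ hη1 (norm_nonneg _)
      (Real.exp_pos _).le)
    refine (norm_propagator_add_le J.isSelfAdjoint_op _ ht0.le).trans (Real.exp_le_exp.2 ?_)
    calc t * ‖J.weightPerturbation ht k‖ ≤ t * (2 * (‖J.op‖ * (2 ^ k / t))) := by
          gcongr
          exact J.norm_weightPerturbation_le ht k
      _ = 2 * (‖J.op‖ * 2 ^ k) := by field_simp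
  · have h1 : J.evolution t φ
        = invWeight ht0 k (propagator (J.op + J.weightPerturbation ht k) t η) := by
      rw [hφ]
      exact congrArg (fun B : EllTwo →L[ℂ] EllTwo => B η) hint
    rw [h1, invWeight_apply, mul_inv_cancel_left₀ (polyWeight_ne_zero ht0 k n)]

theorem abs_position_div_weight_le (n : ℤ) : |(n : ℝ) / polyWeight 1 1 n| ≤ 1 := by
  rw [abs_div, abs_of_pos (polyWeight_pos one_pos 1 n), div_le_one (polyWeight_pos one_pos 1 n)]
  simp [polyWeight]

/-- The bounded operator of multiplication by `n / (1 + |n|)`. -/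
def boundedPosition : EllTwo →L[ℂ] EllTwo :=
  weightedShift (fun n => n / polyWeight 1 1 n) ⟨1, abs_position_div_weight_le⟩ 0

theorem boundedPosition_apply (φ : EllTwo) (n : ℤ) :
    boundedPosition φ n = n * invWeight one_pos 1 φ n := by
  rw [boundedPosition, weightedShift_apply, invWeight_apply, add_zero]
  push_cast
  ring

theorem op_mul_boundedPosition :
    J.op * boundedPosition - boundedPosition * (J.op + J.weightPerturbation le_rfl 1)
      = J.velocity * invWeight one_pos 1 := by
  ext φ n
  change J.op (boundedPosition φ) n
      - boundedPosition ((J.op + J.weightPerturbation le_rfl 1) φ) n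
    = J.velocity (invWeight one_pos 1 φ) n
  rw [op_apply, velocity_apply, boundedPosition_apply, boundedPosition_apply,
    boundedPosition_apply, boundedPosition_apply, invWeight_apply, invWeight_apply,
    invWeight_apply, invWeight_apply, op_add_weightPerturbation_apply]
  have h1 := polyWeight_ne_zero one_pos 1 n
  have h2 := polyWeight_ne_zero one_pos 1 (n - 1)
  have h3 := polyWeight_ne_zero one_pos 1 (n + 1)
  push_cast
  field_simp
  ring

/-- The identity `X_J(t) = X + i t A_t` composed on the right with the inverse weight. All operators
are then bounded, and the proof is the fundamental theorem of calculus with derivative supplied by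
`op_mul_boundedPosition`. -/
theorem heisenberg_eq_add_timeAvg {t : ℝ} (ht : t ≠ 0) :
    propagator J.op (-t) * boundedPosition * propagator (J.op + J.weightPerturbation le_rfl 1) t
      = boundedPosition
        + (Complex.I * t) • (timeAvg J.op J.velocity t * invWeight one_pos 1) := by
  have hint := fun s => propagator_intertwine (J.op_mul_invWeight le_rfl 1) s
  set F : ℝ → EllTwo →L[ℂ] EllTwo := fun s => propagator J.op (-s) * boundedPosition
    * propagator (J.op + J.weightPerturbation le_rfl 1) s with hF
  have hd : ∀ s, HasDerivAt F
      (Complex.I • (heisenbergFlow J.op J.velocity s * invWeight one_pos 1)) s := fun s => by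
    refine (((hasDerivAt_propagator_neg J.op s).mul_const boundedPosition).mul
      (hasDerivAt_propagator (J.op + J.weightPerturbation le_rfl 1) s)).congr_deriv ?_
    rw [heisenbergFlow, mul_assoc (propagator J.op (-s) * J.velocity), hint s,
      ← mul_assoc (propagator J.op (-s) * J.velocity), mul_assoc (propagator J.op (-s)) J.velocity,
      ← op_mul_boundedPosition]
    simp only [sub_mul, mul_sub, smul_sub, neg_smul, neg_mul, mul_neg, smul_mul_assoc,
      mul_smul_comm, mul_assoc, ← sub_eq_add_neg]
  have hcont : Continuous fun s =>
      Complex.I • (heisenbergFlow J.op J.velocity s * invWeight one_pos 1) :=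
    Continuous.const_smul ((continuous_heisenbergFlow _ _).mul continuous_const) Complex.I
  have h1 := intervalIntegral.integral_eq_sub_of_hasDerivAt (a := 0) (b := t)
    (fun s _ => hd s) (hcont.intervalIntegrable _ _)
  have h2 := ((ContinuousLinearMap.mul ℝ (EllTwo →L[ℂ] EllTwo)).flip
    (invWeight one_pos 1)).intervalIntegral_comp_comm
    ((continuous_heisenbergFlow J.op J.velocity).intervalIntegrable
      (μ := MeasureTheory.volume) 0 t)
  simp only [ContinuousLinearMap.flip_apply, ContinuousLinearMap.mul_apply'] at h2
  have h3 : F 0 = boundedPosition := by simp [hF]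
  have h4 : ∫ s in (0 : ℝ)..t, heisenbergFlow J.op J.velocity s
      = (t : ℂ) • timeAvg J.op J.velocity t :=
    ((Complex.coe_smul t _).trans (smul_inv_smul₀ ht _)).symm
  rw [intervalIntegral.integral_smul, h2, h3, h4, smul_mul_assoc, smul_smul] at h1
  change F t = _
  rw [h1]
  abel

theorem exists_weight_one_of_mem_domain {φ : EllTwo} (hφ : φ ∈ positionOp.domain) :
    ∃ χ : EllTwo, φ = invWeight one_pos 1 χ := by
  set ξ : EllTwo := ⟨fun n : ℤ => (n : ℂ) * φ n, hφ⟩ with hξ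
  have hs : ∀ n : ℤ, |((n.sign : ℤ) : ℝ)| ≤ 1 := fun n => by
    rcases lt_trichotomy n 0 with h | h | h
    · simp [Int.sign_eq_neg_one_of_neg h]
    · simp [h]
    · simp [Int.sign_eq_one_of_pos h]
  refine ⟨φ + weightedShift (fun n => ((n.sign : ℤ) : ℝ)) ⟨1, hs⟩ 0 ξ, ?_⟩
  ext n
  rw [invWeight_apply, EllTwo.add_apply, weightedShift_apply, add_zero,
    eq_inv_mul_iff_mul_eq₀ (polyWeight_ne_zero one_pos 1 n)]
  have h1 : ξ n = (n : ℂ) * φ n := rfl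
  have h2 : ((|(n : ℝ)| : ℝ) : ℂ) = ((n.sign : ℤ) : ℂ) * n := by
    have : ((n.sign * n : ℤ) : ℝ) = |(n : ℝ)| := by
      rw [Int.sign_mul_self_eq_abs]
      push_cast
      rfl
    rw [← this]
    push_cast
    rfl
  rw [h1, polyWeight]
  push_cast
  rw [h2]
  ring

/-- Convergence of averaged velocities gives strong convergence of `t⁻¹ X_J(t)`. -/
theorem velocityConverges_of_tendsto {A : EllTwo →L[ℂ] EllTwo}
    (hA : ∀ φ, Tendsto (fun t => timeAvg J.op J.velocity t φ) atTop (𝓝 (A φ))) :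
    J.VelocityConverges (Complex.I • A) := by
  intro φ hφ
  obtain ⟨χ, hχ⟩ := exists_weight_one_of_mem_domain hφ
  set P := propagator (J.op + J.weightPerturbation le_rfl 1) with hP
  have hev : ∀ t n, boundedPosition (P t χ) n = (n : ℂ) * J.evolution t φ n := fun t n => by
    have hint := propagator_intertwine (J.op_mul_invWeight le_rfl 1) t
    have h1 : J.evolution t φ = invWeight one_pos 1 (P t χ) := by
      rw [hχ]
      exact congrArg (fun B : EllTwo →L[ℂ] EllTwo => B χ) hint
    rw [h1, boundedPosition_apply]
  have hdom : ∀ t, φ ∈ (J.heisenberg t).domain := fun t => by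
    change Memℓp (fun n : ℤ => (n : ℂ) * J.evolution t φ n) 2
    rw [← funext (hev t)]
    exact lp.memℓp _
  have hpos : ∀ t, J.heisenberg t ⟨φ, hdom t⟩ = J.evolution (-t) (boundedPosition (P t χ)) :=
    fun t => by
      change J.evolution (-t) (positionOp ⟨J.evolution t φ, hdom t⟩) = _
      congr 1
      ext n
      exact (hev t n).symm
  refine ⟨hdom, ?_⟩
  have h1 : ∀ᶠ t : ℝ in atTop, ((t⁻¹ : ℝ) : ℂ) • boundedPosition χ
      + Complex.I • timeAvg J.op J.velocity t φ
      = ((t⁻¹ : ℝ) : ℂ) • J.heisenberg t ⟨φ, hdom t⟩ := by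
    filter_upwards [eventually_gt_atTop 0] with t ht
    have h2 := congrArg (fun B : EllTwo →L[ℂ] EllTwo => B χ) (J.heisenberg_eq_add_timeAvg ht.ne')
    have h3 : J.heisenberg t ⟨φ, hdom t⟩ = boundedPosition χ
        + (Complex.I * t) • timeAvg J.op J.velocity t φ := by
      rw [hpos, hχ]
      exact h2
    have ht' : (t : ℂ) ≠ 0 := by exact_mod_cast ht.ne'
    rw [h3, smul_add, smul_smul]
    congr 2
    push_cast
    field_simp
  refine Tendsto.congr' h1 ?_
  have h4 : Tendsto (fun t : ℝ => ((t⁻¹ : ℝ) : ℂ)) atTop (𝓝 0) := by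
    exact_mod_cast (Complex.continuous_ofReal.tendsto 0).comp tendsto_inv_atTop_zero
  have h5 := (h4.smul_const (boundedPosition χ)).add ((hA φ).const_smul Complex.I)
  rwa [zero_smul, zero_add] at h5

/-- The velocity is anti-self-adjoint, hence so are its averages and their strong limit; the factor
`i` corrects this. -/
theorem isSelfAdjoint_of_tendsto {A : EllTwo →L[ℂ] EllTwo}
    (hA : ∀ φ, Tendsto (fun t => timeAvg J.op J.velocity t φ) atTop (𝓝 (A φ))) :
    IsSelfAdjoint (Complex.I • A) := by
  have h1 : star A = -A := by
    rw [ContinuousLinearMap.star_eq_adjoint, eq_comm, ContinuousLinearMap.eq_adjoint_iff]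
    intro φ ψ
    have h2 : ∀ t, inner ℂ (-(timeAvg J.op J.velocity t φ)) ψ
        = inner ℂ φ (timeAvg J.op J.velocity t ψ) := fun t => by
      have h3 := star_timeAvg (K := J.velocity) J.isSelfAdjoint_op t
      rw [star_velocity, ← neg_one_smul ℂ J.velocity, timeAvg_smul, neg_one_smul,
        ContinuousLinearMap.star_eq_adjoint, eq_comm, ContinuousLinearMap.eq_adjoint_iff] at h3
      exact h3 φ ψ
    have h4 := ((hA φ).neg).inner (𝕜 := ℂ) (tendsto_const_nhds (x := ψ))
    have h5 := (tendsto_const_nhds (x := φ)).inner (𝕜 := ℂ) (hA ψ)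
    simp only [h2] at h4
    exact tendsto_nhds_unique h4 h5
  rw [IsSelfAdjoint, star_smul, h1]
  simp

end JacobiMatrix

/-! ### Moments and transport exponents. -/

namespace IsDiscreteSchwartz

variable {φ : EllTwo}

theorem summable_norm (hφ : IsDiscreteSchwartz φ) : Summable fun n : ℤ => ‖φ n‖ := by
  have h1 := hφ 1 one_pos
  refine (h1.add (hasSum_ite_eq (0 : ℤ) ‖φ 0‖).summable).of_nonneg_of_le
    (fun n => norm_nonneg _) fun n => ?_
  rw [Real.rpow_one]
  split_ifs with h
  · rw [h]
    simp
  · have h2 : (1 : ℝ) ≤ |(n : ℝ)| := by exact_mod_cast Int.one_le_abs h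
    rw [add_zero]
    exact le_mul_of_one_le_left (norm_nonneg _) h2

theorem memℓp_two_of_summable_norm {f : ℤ → ℂ} (h : Summable fun n => ‖f n‖) : Memℓp f 2 := by
  have h1 : Memℓp f 1 := memℓp_gen (by simpa using h)
  exact h1.of_exponent_ge (by norm_num)

theorem mem_positionOp_domain (hφ : IsDiscreteSchwartz φ) : φ ∈ positionOp.domain := by
  refine memℓp_two_of_summable_norm ((hφ 1 one_pos).congr fun n => ?_)
  rw [Real.rpow_one, norm_mul, Complex.norm_intCast]

theorem exists_weight (hφ : IsDiscreteSchwartz φ) (k : ℕ) :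
    ∃ χ : EllTwo, ∀ n, χ n = (polyWeight 1 k n : ℂ) * φ n := by
  suffices h : Summable fun n : ℤ => ‖(polyWeight 1 k n : ℂ) * φ n‖ from
    ⟨⟨_, memℓp_two_of_summable_norm h⟩, fun n => rfl⟩
  have h1 := hφ (k + 1 : ℕ) (by positivity)
  refine ((hφ.summable_norm.add h1).mul_left (2 ^ k)).of_nonneg_of_le (fun n => norm_nonneg _)
    fun n => ?_
  rw [norm_mul, Complex.norm_real, Real.norm_of_nonneg (polyWeight_pos one_pos k n).le,
    Real.rpow_natCast, ← one_add_mul, ← mul_assoc]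
  gcongr
  have h2 := add_pow_le zero_le_one (abs_nonneg (n : ℝ)) (k + 1)
  rw [one_pow, Nat.add_sub_cancel] at h2
  refine le_trans ?_ h2
  rw [polyWeight, div_one]
  exact pow_le_pow_right₀ (by linarith [abs_nonneg (n : ℝ)]) (Nat.le_succ k)

end IsDiscreteSchwartz

/-- The terms cover `y ≤ δ`, `y ≥ R` and `δ ≤ y ≤ R` respectively. With `y = |n| / t` it bounds the
second moment by the `p`-th, up to two contributions that can be made small, for `p` on either side
of `2`. -/
theorem sq_le_of_three_regimes {y δ R p : ℝ} (hy : 0 ≤ y) (hδ : 0 < δ) (hR : 0 < R) (hp : 0 < p) :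
    y ^ 2 ≤ δ ^ 2 + (R ^ 2)⁻¹ * (1 + y) ^ 4 + R ^ 2 / δ ^ p * y ^ p := by
  have h1 : 0 ≤ (R ^ 2)⁻¹ * (1 + y) ^ 4 := by positivity
  have h2 : 0 ≤ R ^ 2 / δ ^ p * y ^ p := by positivity
  rcases le_total y δ with h | h
  · have : y ^ 2 ≤ δ ^ 2 := by gcongr
    linarith
  rcases le_total y R with h' | h'
  · have h3 : y ^ 2 ≤ R ^ 2 := by gcongr
    have h4 : R ^ 2 ≤ R ^ 2 / δ ^ p * y ^ p := by
      rw [div_mul_eq_mul_div, le_div_iff₀ (by positivity)]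
      gcongr
    have : 0 ≤ δ ^ 2 := by positivity
    linarith
  · have h3 : y ^ 2 ≤ (R ^ 2)⁻¹ * (1 + y) ^ 4 := by
      rw [inv_mul_eq_div, le_div_iff₀ (by positivity)]
      calc y ^ 2 * R ^ 2 ≤ y ^ 2 * y ^ 2 := by gcongr
        _ = y ^ 4 := by ring
        _ ≤ (1 + y) ^ 4 := by
          gcongr
          linarith
    have : 0 ≤ δ ^ 2 := by positivity
    linarith

/-- A quantity comparable to `t ^ p` has logarithmic growth exponent `p`. -/
theorem tendsto_log_div_of_le {m : ℝ → ℝ} {p c C : ℝ} (hp : 0 < p) (hc : 0 < c)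
    (hm : ∀ᶠ t in atTop, c * t ^ p ≤ m t ∧ m t ≤ C * t ^ p) :
    Tendsto (fun t => Real.log (m t) / (p * Real.log t)) atTop (𝓝 1) := by
  have hlog : ∀ x : ℝ, Tendsto (fun t => Real.log x / (p * Real.log t) + 1) atTop (𝓝 1) := fun x => by
    have h := (Real.tendsto_log_atTop.const_mul_atTop hp).const_div_atTop (Real.log x)
    simpa using h.add_const 1
  have key : ∀ x t : ℝ, 0 < x → 1 < t →
      Real.log (x * t ^ p) / (p * Real.log t) = Real.log x / (p * Real.log t) + 1 :=
    fun x t hx ht => by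
      have h0 : 0 < t := by linarith
      have h1 : 0 < Real.log t := Real.log_pos ht
      rw [Real.log_mul hx.ne' (by positivity), Real.log_rpow h0, add_div,
        div_self (by positivity)]
  refine tendsto_of_tendsto_of_tendsto_of_le_of_le' (hlog c) (hlog C) ?_ ?_
  · filter_upwards [hm, eventually_gt_atTop 1] with t ht ht1
    have h0 : 0 < t := by linarith
    rw [← key c t hc ht1]
    have h1 : 0 < Real.log t := Real.log_pos ht1
    have := ht.1
    gcongr
  · filter_upwards [hm, eventually_gt_atTop 1] with t ht ht1
    have h0 : 0 < t := by linarith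
    have h1 : 0 < Real.log t := Real.log_pos ht1
    have h2 : 0 < t ^ p := by positivity
    have h3 : c ≤ C := le_of_mul_le_mul_right (ht.1.trans ht.2) h2
    have h4 : 0 < m t := (mul_pos hc h2).trans_le ht.1
    rw [← key C t (hc.trans_le h3) ht1]
    have := ht.2
    gcongr

namespace JacobiMatrix

variable (J : JacobiMatrix) {φ : EllTwo}

theorem norm_evolution (t : ℝ) (φ : EllTwo) : ‖J.evolution t φ‖ = ‖φ‖ :=
  norm_propagator_apply J.isSelfAdjoint_op t φ

theorem exists_weighted_moment_bound (hφ : IsDiscreteSchwartz φ) (k : ℕ) :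
    ∃ C : ℝ, ∀ t : ℝ, 1 ≤ t →
      (Summable fun n : ℤ => polyWeight t k n ^ 2 * ‖J.evolution t φ n‖ ^ 2) ∧
        ∑' n : ℤ, polyWeight t k n ^ 2 * ‖J.evolution t φ n‖ ^ 2 ≤ C := by
  obtain ⟨χ, hχ⟩ := hφ.exists_weight k
  refine ⟨(Real.exp (2 * (‖J.op‖ * 2 ^ k)) * ‖χ‖) ^ 2, fun t ht => ?_⟩
  obtain ⟨ξ, hξ, hξn⟩ := J.exists_weighted_evolution k hχ ht
  have h1 : ∀ n : ℤ, ‖ξ n‖ ^ 2 = polyWeight t k n ^ 2 * ‖J.evolution t φ n‖ ^ 2 := fun n => by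
    rw [hξn, norm_mul, mul_pow, Complex.norm_real, Real.norm_eq_abs, sq_abs]
  have h2 := EllTwo.summable_norm_sq ξ
  have h3 := EllTwo.norm_sq_eq_tsum ξ
  simp only [h1] at h2 h3
  refine ⟨h2, ?_⟩
  rw [← h3]
  gcongr

/-- The moment as a real number. -/
def realMoment (φ : EllTwo) (p t : ℝ) : ℝ :=
  ∑' n : ℤ, (|(n : ℝ)| ^ p + 1) * ‖J.evolution t φ n‖ ^ 2

theorem abs_rpow_add_one_le {p t : ℝ} (hp : 0 < p) (ht : 1 ≤ t) {k : ℕ} (hk : p ≤ 2 * k) (n : ℤ) :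
    |(n : ℝ)| ^ p + 1 ≤ 2 * t ^ p * polyWeight t k n ^ 2 := by
  have ht0 : 0 < t := by linarith
  set y : ℝ := |(n : ℝ)| / t with hy
  have hy0 : 0 ≤ y := by positivity
  have h1 : |(n : ℝ)| = t * y := by
    rw [hy]
    field_simp
  have h2 : (1 + y) ^ p ≤ polyWeight t k n ^ 2 := by
    rw [polyWeight, ← pow_mul, ← Real.rpow_natCast]
    refine Real.rpow_le_rpow_of_exponent_le (by linarith) ?_
    push_cast
    linarith
  have h3 : y ^ p ≤ (1 + y) ^ p := by
    gcongr
    linarith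
  have h4 : 1 ≤ t ^ p := Real.one_le_rpow ht hp.le
  have h5 : 1 ≤ polyWeight t k n ^ 2 := one_le_pow₀ (one_le_polyWeight ht0 k n)
  rw [h1, Real.mul_rpow ht0.le hy0]
  have h6 : t ^ p * y ^ p ≤ t ^ p * polyWeight t k n ^ 2 := by
    have := h3.trans h2
    gcongr
  have h7 : 1 * 1 ≤ t ^ p * polyWeight t k n ^ 2 := mul_le_mul h4 h5 zero_le_one (by linarith)
  linarith

theorem exists_realMoment_le (hφ : IsDiscreteSchwartz φ) {p : ℝ} (hp : 0 < p) :
    ∃ C : ℝ, ∀ t : ℝ, 1 ≤ t →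
      (Summable fun n : ℤ => (|(n : ℝ)| ^ p + 1) * ‖J.evolution t φ n‖ ^ 2) ∧
        J.realMoment φ p t ≤ C * t ^ p := by
  have hk : p ≤ 2 * (⌈p⌉₊ : ℕ) := by linarith [Nat.le_ceil p]
  obtain ⟨C, hC⟩ := J.exists_weighted_moment_bound hφ ⌈p⌉₊
  refine ⟨2 * C, fun t ht => ?_⟩
  obtain ⟨h1, h2⟩ := hC t ht
  have ht0 : 0 < t := by linarith
  have h3 : ∀ n : ℤ, (|(n : ℝ)| ^ p + 1) * ‖J.evolution t φ n‖ ^ 2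
      ≤ 2 * t ^ p * (polyWeight t ⌈p⌉₊ n ^ 2 * ‖J.evolution t φ n‖ ^ 2) := fun n => by
    rw [← mul_assoc]
    gcongr
    exact abs_rpow_add_one_le hp ht hk n
  have h4 : Summable fun n : ℤ => (|(n : ℝ)| ^ p + 1) * ‖J.evolution t φ n‖ ^ 2 :=
    (h1.mul_left (2 * t ^ p)).of_nonneg_of_le (fun n => by positivity) h3
  refine ⟨h4, (h4.tsum_le_tsum h3 (h1.mul_left _)).trans ?_⟩
  rw [tsum_mul_left]
  calc _ ≤ 2 * t ^ p * C := by gcongr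
    _ = 2 * C * t ^ p := by ring

/-- The second moment is the squared norm of the Heisenberg evolved position. -/
theorem norm_heisenberg_sq (t : ℝ) (h : φ ∈ (J.heisenberg t).domain) :
    ‖J.heisenberg t ⟨φ, h⟩‖ ^ 2 = ∑' n : ℤ, (n : ℝ) ^ 2 * ‖J.evolution t φ n‖ ^ 2 := by
  have h1 : ‖J.heisenberg t ⟨φ, h⟩‖ = ‖positionOp ⟨J.evolution t φ, h⟩‖ := J.norm_evolution (-t) _
  rw [h1, EllTwo.norm_sq_eq_tsum]
  refine tsum_congr fun n => ?_
  change ‖(n : ℂ) * J.evolution t φ n‖ ^ 2 = _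
  rw [norm_mul, mul_pow, Complex.norm_intCast, sq_abs]

theorem exists_le_realMoment (hφ : IsDiscreteSchwartz φ) {Q : EllTwo →L[ℂ] EllTwo}
    (hQ : J.VelocityConverges Q) (hQφ : Q φ ≠ 0) {p : ℝ} (hp : 0 < p) :
    ∃ c : ℝ, 0 < c ∧ ∀ᶠ t in atTop, c * t ^ p ≤ J.realMoment φ p t := by
  obtain ⟨hdom, htend⟩ := hQ φ hφ.mem_positionOp_domain
  -- Order `2` squares to `(1 + |n| / t) ^ 4`, the far-regime weight in `sq_le_of_three_regimes`.
  obtain ⟨C, hC⟩ := J.exists_weighted_moment_bound hφ 2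
  obtain ⟨C', hC'⟩ := J.exists_realMoment_le hφ hp
  set v : ℝ := ‖Q φ‖ ^ 2 with hv
  have hv0 : 0 < v := by positivity
  have hC0 : 0 ≤ C := le_trans (tsum_nonneg fun n => by positivity) (hC 1 le_rfl).2
  obtain ⟨δ, hδ, hδv⟩ : ∃ δ : ℝ, 0 < δ ∧ δ ^ 2 * ‖φ‖ ^ 2 ≤ v / 8 := by
    have h1 : Tendsto (fun δ : ℝ => δ ^ 2 * ‖φ‖ ^ 2) (𝓝[>] 0) (𝓝 0) := by
      have : Tendsto (fun δ : ℝ => δ ^ 2 * ‖φ‖ ^ 2) (𝓝 0) (𝓝 (0 ^ 2 * ‖φ‖ ^ 2)) :=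
        (Continuous.tendsto (by fun_prop) 0)
      simpa using this.mono_left nhdsWithin_le_nhds
    obtain ⟨δ, h2, h3⟩ := ((h1.eventually_le_const (u := v / 8) (by positivity)).and
      self_mem_nhdsWithin).exists
    exact ⟨δ, h3, h2⟩
  -- The near and far regimes are each kept below `v / 8`. As the rescaled second moment is
  -- eventually at least `v / 2`, the middle regime carries at least `v / 4`. The `+ 1` keeps `R`
  -- positive when `C = 0`.
  set R : ℝ := Real.sqrt (8 * (C + 1) / v) with hR
  have hR0 : 0 < R := Real.sqrt_pos.2 (by positivity)
  have hRv : (R ^ 2)⁻¹ * C ≤ v / 8 := by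
    rw [hR, Real.sq_sqrt (by positivity), inv_div, div_mul_eq_mul_div, div_le_div_iff₀
      (by positivity) (by norm_num)]
    nlinarith
  set D : ℝ := R ^ 2 / δ ^ p with hD
  have hD0 : 0 < D := by positivity
  refine ⟨v / (4 * D), by positivity, ?_⟩
  have hev := (htend.norm.pow 2).eventually_const_le (u := v / 2) (by linarith)
  filter_upwards [hev, eventually_ge_atTop 1] with t ht ht1
  have ht0 : 0 < t := by linarith
  obtain ⟨hs2, hC2⟩ := hC t ht1
  obtain ⟨hsp, -⟩ := hC' t ht1
  have hs0 := EllTwo.summable_norm_sq (J.evolution t φ)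
  have h0 := EllTwo.norm_sq_eq_tsum (J.evolution t φ)
  rw [norm_evolution] at h0
  rw [norm_smul, mul_pow, norm_heisenberg_sq, Complex.norm_real, Real.norm_eq_abs, sq_abs]
    at ht
  have hrhs := ((hs0.mul_left (δ ^ 2)).add (hs2.mul_left (R ^ 2)⁻¹)).add
    (hsp.mul_left (D * (t ^ p)⁻¹))
  have hterm : ∀ n : ℤ, t⁻¹ ^ 2 * ((n : ℝ) ^ 2 * ‖J.evolution t φ n‖ ^ 2)
      ≤ δ ^ 2 * ‖J.evolution t φ n‖ ^ 2
        + (R ^ 2)⁻¹ * (polyWeight t 2 n ^ 2 * ‖J.evolution t φ n‖ ^ 2)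
        + D * (t ^ p)⁻¹ * ((|(n : ℝ)| ^ p + 1) * ‖J.evolution t φ n‖ ^ 2) := fun n => by
    have h1 := sq_le_of_three_regimes (y := |(n : ℝ)| / t) (by positivity) hδ hR0 hp
    have h2 : (|(n : ℝ)| / t) ^ p ≤ (t ^ p)⁻¹ * (|(n : ℝ)| ^ p + 1) := by
      rw [Real.div_rpow (abs_nonneg _) ht0.le, div_eq_inv_mul]
      gcongr
      linarith
    have h3 : (|(n : ℝ)| / t) ^ 2 = t⁻¹ ^ 2 * (n : ℝ) ^ 2 := by
      rw [div_eq_inv_mul, mul_pow, sq_abs]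
    have h4 : (1 + |(n : ℝ)| / t) ^ 4 = polyWeight t 2 n ^ 2 := by
      rw [polyWeight, ← pow_mul]
    rw [h3, h4, ← hD] at h1
    have h5 := mul_le_mul_of_nonneg_left h2 hD0.le
    have h6 := mul_le_mul_of_nonneg_right (h1.trans (add_le_add_right h5 _))
      (sq_nonneg ‖J.evolution t φ n‖)
    linarith
  have hlhs : Summable fun n : ℤ => t⁻¹ ^ 2 * ((n : ℝ) ^ 2 * ‖J.evolution t φ n‖ ^ 2) :=
    hrhs.of_nonneg_of_le (fun n => by positivity) hterm
  have h1 := hlhs.tsum_le_tsum hterm hrhs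
  rw [((hs0.mul_left (δ ^ 2)).add (hs2.mul_left (R ^ 2)⁻¹)).tsum_add
    (hsp.mul_left (D * (t ^ p)⁻¹)), (hs0.mul_left (δ ^ 2)).tsum_add (hs2.mul_left (R ^ 2)⁻¹),
    tsum_mul_left, tsum_mul_left, tsum_mul_left, tsum_mul_left, ← h0] at h1
  have h2 : (R ^ 2)⁻¹ * ∑' n : ℤ, polyWeight t 2 n ^ 2 * ‖J.evolution t φ n‖ ^ 2 ≤ v / 8 :=
    (mul_le_mul_of_nonneg_left hC2 (by positivity)).trans hRv
  have h3 : v / 4 ≤ D * (t ^ p)⁻¹ * J.realMoment φ p t := by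
    rw [realMoment]
    linarith
  have h4 : 0 < t ^ p := by positivity
  rw [div_mul_eq_mul_div, div_le_iff₀ (by positivity)]
  rw [mul_assoc, inv_mul_eq_div, mul_div_assoc', le_div_iff₀ h4] at h3
  linarith

theorem tendsto_log_moment (hφ : IsDiscreteSchwartz φ) {Q : EllTwo →L[ℂ] EllTwo}
    (hQ : J.VelocityConverges Q) (hQφ : Q φ ≠ 0) {p : ℝ} (hp : 0 < p) :
    Tendsto (fun t : ℝ => ENNReal.log (J.moment φ p t) / ((p * Real.log t : ℝ) : EReal)) atTop
      (𝓝 1) := by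
  obtain ⟨c, hc, hlow⟩ := J.exists_le_realMoment hφ hQ hQφ hp
  obtain ⟨C, hup⟩ := J.exists_realMoment_le hφ hp
  have h1 := tendsto_log_div_of_le (m := J.realMoment φ p) (C := C) hp hc (by
    filter_upwards [hlow, eventually_ge_atTop 1] with t ht ht1
    exact ⟨ht, (hup t ht1).2⟩)
  have h2 := (continuous_coe_real_ereal.tendsto 1).comp h1
  rw [EReal.coe_one] at h2
  refine h2.congr' ?_
  filter_upwards [hlow, eventually_ge_atTop 1] with t ht ht1
  have ht0 : 0 < t := by linarith
  have h3 : 0 < J.realMoment φ p t := (by positivity : 0 < c * t ^ p).trans_le ht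
  have h4 : J.moment φ p t = ENNReal.ofReal (J.realMoment φ p t) :=
    (ENNReal.ofReal_tsum_of_nonneg (fun n => by positivity) (hup t ht1).1).symm
  rw [Function.comp_apply, EReal.coe_div, h4, ENNReal.log_ofReal_of_pos h3]

end JacobiMatrix

end

theorem mainTheorem3 (J : JacobiMatrix) (hJ : J.ECInfty) :
    (∃ Q : EllTwo →L[ℂ] EllTwo, IsSelfAdjoint Q ∧ J.VelocityConverges Q ∧
      {φ : EllTwo | Q φ = 0} ∩ {φ : EllTwo | Memℓp (fun n : ℤ => φ n) 1} = {0}) ∧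
    ∀ φ : EllTwo, IsDiscreteSchwartz φ → φ ≠ 0 → ∀ p : ℝ, 0 < p →
      J.betaPlus φ p = 1 ∧ J.betaMinus φ p = 1 := by
  obtain ⟨A, hA, hker⟩ := hJ.exists_limit
  have hker' : ∀ φ : EllTwo, (Summable fun k : ℤ => ‖φ k‖) → (Complex.I • A) φ = 0 → φ = 0 :=
    fun φ hφ h => hker φ hφ ((smul_eq_zero.1 h).resolve_left Complex.I_ne_zero)
  have hconv := J.velocityConverges_of_tendsto hA
  refine ⟨⟨Complex.I • A, J.isSelfAdjoint_of_tendsto hA, hconv, ?_⟩, fun φ hφ h0 p hp => ?_⟩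
  · ext φ
    constructor
    · rintro ⟨h1, h2⟩
      have h3 : Summable fun k : ℤ => ‖φ k‖ := by
        have := Memℓp.summable (p := 1) (by norm_num) h2
        simpa using this
      exact hker' φ h3 h1
    · rintro rfl
      exact ⟨map_zero _, zero_memℓp⟩
  · have h1 := J.tendsto_log_moment hφ hconv (fun h => h0 (hker' φ hφ.summable_norm h)) hp
    exact ⟨h1.limsup_eq, h1.liminf_eq⟩
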